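/- Let $D\ge 2$ be an integer and let $p>1$ be a real number. For an open, bounded, convex, non-empty set $\Omega\subset\mathbb{R}^D$ let $u_p\in W_0^{1,p}(\Omega)$ be the unique weak solution of $-\operatorname{div}(|\nabla u|^{p-2}\nabla u)=1$ in $\Omega$, $u=0$ on $\partial\Omega$; put $T_p(\Omega):=\int_\Omega u_p\,dx$ and $$T(p;\Omega):=|\Omega|^{p-1}\,T_p(\Omega)^{1-p},$$ where $|\Omega|$ is the Lebesgue measure of $\Omega$. Let $$\delta(\Omega):=\frac1{|\Omega|}\int_\Omega \operatorname{dist}(x,\partial\Omega)\,dx,$$ and for $r>0$ let $\mathcal{P}^D[r]$ be the family of all open, bounded, convex sets $\Omega\subset\mathbb{R}^D$ with $\delta(\Omega)=r$. Then there exists a constant $\overline\gamma_{D,p}\in\left[\frac{2}{D(D+1)},1\right)$, depending only on $D$ and $p$, such that for all real numbers $0<a<b$ the following hold. (i) One has $$T(p;\Omega_b)\le T(p;\Omega_a)\qquad\text{for all }\Omega_a\in\mathcal{P}^D[a]\text{ and all }\Omega_b\in\mathcal{P}^D[b]$$ if and only if $\overline\gamma_{D,p}\,b\ge a$. (ii)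 If $\overline\gamma_{D,p}\,b>a$, then $T(p;\Omega_b)<T(p;\Omega_a)$ for all $\Omega_a\in\mathcal{P}^D[a]$ and all $\Omega_b\in\mathcal{P}^D[b]$. (iii) If $\overline\gamma_{D,p}\,b=a$, then equality holds asymptotically: there exist sequences $(\omega_n)_n\subset\mathcal{P}^D[a]$ and $(\Omega_n)_n\subset\mathcal{P}^D[b]$ such that $T(p;\Omega_n)$ and $T(p;\omega_n)$ converge, as $n\to\infty$, to the same finite limit. -/

import Mathlib

open MeasureTheory Filter Topology
open scoped ContDiff

noncomputable section

namespace Torsion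

/-- The `D`-dimensional Euclidean space. -/
abbrev E (D : ℕ) : Type := EuclideanSpace ℝ (Fin D)

/-- `φ ∈ C_c^∞(Ω)`: smooth, with compact support contained in `Ω`. -/
structure IsTestFunction {D : ℕ} (Ω : Set (E D)) (φ : E D → ℝ) : Prop where
  smooth : ContDiff ℝ ∞ φ
  compact : HasCompactSupport φ
  support : tsupport φ ⊆ Ω

/-- `G` is a weak (distributional) gradient of `u` on `Ω`. -/
def IsWeakGradient {D : ℕ} (Ω : Set (E D)) (u : E D → ℝ) (G : E D → E D) : Prop :=
  ∀ φ : E D → ℝ, IsTestFunction Ω φ →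
    ∫ x in Ω, u x • gradient φ x = -∫ x in Ω, φ x • G x

/-- `u ∈ W^{1,p}(Ω)`, with weak gradient `G`. -/
structure MemW1p {D : ℕ} (p : ℝ) (Ω : Set (E D)) (u : E D → ℝ) (G : E D → E D) : Prop where
  memLp : MemLp u (ENNReal.ofReal p) (volume.restrict Ω)
  memLp_grad : MemLp G (ENNReal.ofReal p) (volume.restrict Ω)
  weakGrad : IsWeakGradient Ω u G

/-- `u ∈ W_0^{1,p}(Ω)`, with weak gradient `G`: `u` lies in `W^{1,p}(Ω)` and is a limit, in the
norm of `W^{1,p}(Ω)`, of functions from `C_c^∞(Ω)`. -/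
structure MemW01p {D : ℕ} (p : ℝ) (Ω : Set (E D)) (u : E D → ℝ) (G : E D → E D) : Prop
    extends MemW1p p Ω u G where
  approx : ∃ φ : ℕ → E D → ℝ, (∀ n, IsTestFunction Ω (φ n)) ∧
    Tendsto (fun n => eLpNorm (fun x => φ n x - u x) (ENNReal.ofReal p) (volume.restrict Ω))
      atTop (𝓝 0) ∧
    Tendsto (fun n => eLpNorm (fun x => gradient (φ n) x - G x) (ENNReal.ofReal p)
      (volume.restrict Ω)) atTop (𝓝 0)

/-- `u` is a `p`-torsion function of `Ω`: a weak solution `u ∈ W_0^{1,p}(Ω)` of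
`-div (|∇u|^{p-2} ∇u) = 1` in `Ω`, `u = 0` on `∂Ω`. (Where `∇u = 0` the integrand on the left
is `0`, whatever the value of the power.) -/
def IsTorsionFunction {D : ℕ} (p : ℝ) (Ω : Set (E D)) (u : E D → ℝ) : Prop :=
  ∃ G : E D → E D, MemW01p p Ω u G ∧
    ∀ (v : E D → ℝ) (H : E D → E D), MemW01p p Ω v H →
      ∫ x in Ω, ‖G x‖ ^ (p - 2) * inner ℝ (G x) (H x) = ∫ x in Ω, v x

open Classical in
/-- The `p`-torsional rigidity `T_p(Ω) = ∫_Ω u_p`, with `u_p` the `p`-torsion function of `Ω`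
(which exists and is unique almost everywhere when `Ω` is bounded and open and `p > 1`). -/
def torsionalRigidity {D : ℕ} (p : ℝ) (Ω : Set (E D)) : ℝ :=
  if h : ∃ u : E D → ℝ, IsTorsionFunction p Ω u then ∫ x in Ω, h.choose x else 0

/-- The normalized `p`-torsional rigidity `T(p;Ω) = |Ω|^{p-1} T_p(Ω)^{1-p}`. -/
def normTorsion {D : ℕ} (p : ℝ) (Ω : Set (E D)) : ℝ :=
  (volume.real Ω) ^ (p - 1) * (torsionalRigidity p Ω) ^ (1 - p)

/-- The average over `Ω` of the distance to the boundary of `Ω`. -/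
def avgDist {D : ℕ} (Ω : Set (E D)) : ℝ :=
  (1 / volume.real Ω) * ∫ x in Ω, Metric.infDist x (frontier Ω)

/-- The open, bounded, convex sets in `ℝ^D` whose average distance to the boundary is `r`
(for `r > 0` such sets are non-empty). -/
def convexDomains (D : ℕ) (r : ℝ) : Set (Set (E D)) :=
  {Ω | IsOpen Ω ∧ Bornology.IsBounded Ω ∧ Convex ℝ Ω ∧ avgDist Ω = r}

end Torsion

end

/-! Let `C` be the norm of the functional `u ↦ ∫ u` on `W_0^{1,p}(Ω)`, let `q` be the exponent
conjugate to `p`, and put `F(Ω) = δ(Ω) |Ω|^{1/q} / C`. Testing the equation with its solution gives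
`T_p(Ω) = C^q`, hence `T(p;Ω) = (F(Ω) / δ(Ω))^p`. Since `F` is invariant under dilations, `T(p;·)`
takes on `𝒫^D[r]` exactly the values `(s / r)^p` with `s` in the range of `F`, and the sharp
constant is `inf F / sup F`.

Integrating along the direction to the nearest supporting hyperplane one gets `∫ |φ| ≤ (sup dist) ∫
|∇φ|` for test functions, and concavity of the distance function gives `sup dist ≤ (D + 1) δ(Ω)`;
together they yield `F ≥ 1 / (D + 1)`. The distance function itself, whose gradient has norm at most
`1`, is admissible in the definition of `C` and yields `F ≤ 1`.

The constant is less than `1` because `F` is not constant: on long boxes, `F` drops below every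
number larger than the value `½ (q + 1)^{1/q}` of the slab, which Bernoulli's inequality shows to be
smaller than the lower bound `D / (D + 1) ((D + q) / D)^{1/q}` for `F` on the unit ball. -/

namespace Torsion

section FirstArgmin

variable {ι α β : Type*} [LinearOrder ι] [LinearOrder β] {l : ι → α → β}

/-- The points at which `i` is the first index minimizing `l i`. Breaking ties in favour of the
first index makes these sets pairwise disjoint. -/
def firstArgmin (l : ι → α → β) (i : ι) : Set α :=
  {x | (∀ j < i, l i x < l j x) ∧ ∀ j, l i x ≤ l j x}

theorem pairwise_disjoint_firstArgmin : Pairwise (Function.onFun Disjoint (firstArgmin l)) := by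
  intro i j hij
  refine Set.disjoint_left.2 ?_
  rintro x ⟨hi, hi'⟩ ⟨hj, hj'⟩
  rcases hij.lt_or_gt with h | h
  · exact (hj i h).not_ge (hi' j)
  · exact (hi j h).not_ge (hj' i)

theorem iUnion_firstArgmin [Finite ι] [Nonempty ι] : ⋃ i, firstArgmin l i = Set.univ := by
  refine Set.eq_univ_of_forall fun x => Set.mem_iUnion.2 ?_
  obtain ⟨k, hk⟩ := Finite.exists_min fun i => l i x
  obtain ⟨i, hi, hfirst⟩ :=
    Set.exists_min_image {i | ∀ j, l i x ≤ l j x} id (Set.toFinite _) ⟨k, hk⟩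
  exact ⟨i, fun j hj => lt_of_not_ge fun hji =>
    (hfirst j fun m => hji.trans (hi m)).not_gt hj, hi⟩

theorem measurableSet_firstArgmin [Countable ι] [MeasurableSpace α] [TopologicalSpace β]
    [MeasurableSpace β] [OpensMeasurableSpace β] [OrderClosedTopology β]
    [SecondCountableTopology β] (hl : ∀ i, Measurable (l i)) (i : ι) :
    MeasurableSet (firstArgmin l i) := by
  simp only [firstArgmin, Set.ofPred_and, Set.ofPred_forall]
  exact (MeasurableSet.iInter fun j => .iInter fun _ => measurableSet_lt (hl i) (hl j)).inter
    (.iInter fun j => measurableSet_le (hl i) (hl j))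

theorem add_smul_mem_firstArgmin {V : Type*} [NormedAddCommGroup V] [InnerProductSpace ℝ V]
    {n : ι → V} {c : ι → ℝ} (hn : ∀ i, ‖n i‖ = 1) {i : ι} {x : V}
    (hx : x ∈ firstArgmin (fun i x => c i - inner ℝ (n i) x) i) {s : ℝ} (hs : 0 ≤ s) :
    x + s • n i ∈ firstArgmin (fun i x => c i - inner ℝ (n i) x) i := by
  have hself : inner ℝ (n i) (n i) = (1 : ℝ) := by rw [real_inner_self_eq_norm_sq, hn, one_pow]
  have hle : ∀ j, s * inner ℝ (n j) (n i) ≤ s := fun j =>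
    mul_le_of_le_one_right hs (by simpa only [hn, one_mul] using real_inner_le_norm (n j) (n i))
  simp only [firstArgmin, Set.mem_ofPred_eq, inner_add_right, inner_smul_right, hself] at hx ⊢
  exact ⟨fun j hj => by linarith [hx.1 j hj, hle j], fun j => by linarith [hx.2 j, hle j]⟩

end FirstArgmin

section LinearIsoperimetry

theorem enorm_le_lintegral_enorm_fderiv_of_eq_zero {V F : Type*} [NormedAddCommGroup V]
    [NormedSpace ℝ V] [NormedAddCommGroup F] [NormedSpace ℝ F] [CompleteSpace F] {v : V → F}
    (hv : ContDiff ℝ 1 v) {n x : V} (hn : ‖n‖ ≤ 1) {r : ℝ} (hr : 0 ≤ r) (h0 : v (x + r • n) = 0) :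
    ‖v x‖ₑ ≤ ∫⁻ s in Set.Ioc 0 r, ‖fderiv ℝ v (x + s • n)‖ₑ := by
  have hline (s : ℝ) : HasDerivAt (fun s : ℝ => x + s • n) n s := by
    simpa only [one_smul] using ((hasDerivAt_id' s).smul_const n).const_add x
  have hderiv (s : ℝ) : HasDerivAt (fun s : ℝ => v (x + s • n)) (fderiv ℝ v (x + s • n) n) s :=
    (hv.differentiable one_ne_zero _).hasFDerivAt.comp_hasDerivAt s (hline s)
  have hcont : Continuous fun s : ℝ => fderiv ℝ v (x + s • n) n := by
    have := hv.continuous_fderiv one_ne_zero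
    fun_prop
  have hftc : ∫ s in Set.Ioc 0 r, fderiv ℝ v (x + s • n) n = -v x := by
    rw [← intervalIntegral.integral_of_le hr, intervalIntegral.integral_eq_sub_of_hasDerivAt
      (fun s _ => hderiv s) (hcont.intervalIntegrable 0 r), h0, zero_smul, add_zero, zero_sub]
  have hn' : ‖n‖ₑ ≤ 1 := by simpa only [← ofReal_norm, ENNReal.ofReal_le_one] using hn
  rw [← enorm_neg, ← hftc]
  refine (enorm_integral_le_lintegral_enorm _).trans (lintegral_mono fun s => ?_)
  exact ((fderiv ℝ v (x + s • n)).le_opENorm n).trans (mul_le_of_le_one_right' hn')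

/-- Bound `v x` by the integral of the derivative over the segment from `x` to the zero of `v`, then
integrate over `x` and use translation invariance. -/
theorem setLIntegral_enorm_le_of_exists_eq_zero {V F : Type*} [NormedAddCommGroup V]
    [NormedSpace ℝ V] [MeasurableSpace V] [BorelSpace V] [SecondCountableTopology V]
    [NormedAddCommGroup F] [NormedSpace ℝ F] [CompleteSpace F] {μ : Measure V} [SFinite μ]
    [μ.IsAddRightInvariant] {v : V → F} (hv : ContDiff ℝ 1 v) {S : Set V} (hS : MeasurableSet S)
    {n : V} (hn : ‖n‖ ≤ 1) (hSn : ∀ x ∈ S, ∀ s : ℝ, 0 ≤ s → x + s • n ∈ S) {K : ℝ}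
    (hK : ∀ x ∈ S, v x ≠ 0 → ∃ r ∈ Set.Icc 0 K, v (x + r • n) = 0) :
    ∫⁻ x in S, ‖v x‖ₑ ∂μ ≤ ENNReal.ofReal K * ∫⁻ x in S, ‖fderiv ℝ v x‖ₑ ∂μ := by
  set f : V → ENNReal := S.indicator fun x => ‖fderiv ℝ v x‖ₑ
  have hf : Measurable f := (hv.continuous_fderiv one_ne_zero).enorm.measurable.indicator hS
  have hline : ∀ x ∈ S, ‖v x‖ₑ ≤ ∫⁻ s in Set.Ioc 0 K, f (x + s • n) := by
    intro x hx
    rcases eq_or_ne (v x) 0 with h0 | h0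
    · simp only [h0, enorm_zero, zero_le]
    obtain ⟨r, hr, hvr⟩ := hK x hx h0
    calc ‖v x‖ₑ ≤ ∫⁻ s in Set.Ioc 0 r, ‖fderiv ℝ v (x + s • n)‖ₑ :=
          enorm_le_lintegral_enorm_fderiv_of_eq_zero hv hn hr.1 hvr
      _ = ∫⁻ s in Set.Ioc 0 r, f (x + s • n) :=
          setLIntegral_congr_fun measurableSet_Ioc fun s hs =>
            (Set.indicator_of_mem (hSn x hx s hs.1.le) fun x => ‖fderiv ℝ v x‖ₑ).symm
      _ ≤ ∫⁻ s in Set.Ioc 0 K, f (x + s • n) :=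
          lintegral_mono_set (Set.Ioc_subset_Ioc_right hr.2)
  calc ∫⁻ x in S, ‖v x‖ₑ ∂μ ≤ ∫⁻ x in S, (∫⁻ s in Set.Ioc 0 K, f (x + s • n)) ∂μ :=
        setLIntegral_mono' hS hline
    _ ≤ ∫⁻ x, (∫⁻ s in Set.Ioc 0 K, f (x + s • n)) ∂μ := setLIntegral_le_lintegral _ _
    _ = ∫⁻ s in Set.Ioc 0 K, (∫⁻ x, f (x + s • n) ∂μ) :=
        lintegral_lintegral_swap (hf.comp (by fun_prop)).aemeasurable
    _ = ∫⁻ _ in Set.Ioc 0 K, (∫⁻ x, f x ∂μ) :=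
        lintegral_congr fun s => lintegral_add_right_eq_self f (s • n)
    _ = ENNReal.ofReal K * ∫⁻ x in S, ‖fderiv ℝ v x‖ₑ ∂μ := by
        rw [lintegral_const, Measure.restrict_apply_univ, Real.volume_Ioc, sub_zero, mul_comm,
          lintegral_indicator hS]

variable {V : Type*} [NormedAddCommGroup V] [InnerProductSpace ℝ V]

/-- Cut space into the cells in which a given half-space boundary is the nearest one; each cell is
invariant under translation towards its half-space boundary. -/
theorem lintegral_enorm_le_of_halfspaces [MeasurableSpace V] [BorelSpace V]
    [SecondCountableTopology V] {F : Type*} [NormedAddCommGroup F] [NormedSpace ℝ F]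
    [CompleteSpace F] {μ : Measure V} [SFinite μ] [μ.IsAddRightInvariant] {ι : Type*} [Finite ι]
    [LinearOrder ι] {n : ι → V} {c : ι → ℝ} (hn : ∀ i, ‖n i‖ = 1) {v : V → F}
    (hv : ContDiff ℝ 1 v) (h0 : ∀ x i, c i ≤ inner ℝ (n i) x → v x = 0) {K : ℝ}
    (hK : ∀ x, v x ≠ 0 → ∃ i, c i - inner ℝ (n i) x ≤ K) :
    ∫⁻ x, ‖v x‖ₑ ∂μ ≤ ENNReal.ofReal K * ∫⁻ x, ‖fderiv ℝ v x‖ₑ ∂μ := by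
  by_cases hv0 : ∀ x, v x = 0
  · simp only [hv0, enorm_zero, lintegral_zero, zero_le]
  obtain ⟨x₀, hx₀⟩ := not_forall.1 hv0
  have : Nonempty ι := ⟨(hK x₀ hx₀).choose⟩
  set S := firstArgmin fun i x => c i - inner ℝ (n i) x
  have hSm (i : ι) : MeasurableSet (S i) :=
    measurableSet_firstArgmin (fun i => Continuous.measurable (by fun_prop)) i
  have hsum (f : V → ENNReal) : ∫⁻ x, f x ∂μ = ∑' i, ∫⁻ x in S i, f x ∂μ := by
    rw [← setLIntegral_univ, ← iUnion_firstArgmin (l := fun i x => c i - inner ℝ (n i) x),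
      lintegral_iUnion hSm pairwise_disjoint_firstArgmin]
  have hcell (i : ι) : ∫⁻ x in S i, ‖v x‖ₑ ∂μ ≤
      ENNReal.ofReal K * ∫⁻ x in S i, ‖fderiv ℝ v x‖ₑ ∂μ := by
    refine setLIntegral_enorm_le_of_exists_eq_zero hv (hSm i) (hn i).le
      (fun x hx s hs => add_smul_mem_firstArgmin hn hx hs) fun x hx hvx => ?_
    obtain ⟨j, hj⟩ := hK x hvx
    refine ⟨c i - inner ℝ (n i) x, ⟨?_, (hx.2 j).trans hj⟩, h0 _ i (le_of_eq ?_)⟩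
    · exact sub_nonneg.2 (not_le.1 fun h => hvx (h0 x i h)).le
    · rw [inner_add_right, inner_smul_right, real_inner_self_eq_norm_sq, hn]
      ring
  rw [hsum, hsum, ← ENNReal.tsum_mul_left]
  exact ENNReal.tsum_le_tsum hcell

theorem exists_norm_eq_one_forall_inner_lt [CompleteSpace V] {Ω : Set V} (hc : Convex ℝ Ω)
    (ho : IsOpen Ω) (hne : Ω.Nonempty) {y : V} (hy : y ∉ Ω) :
    ∃ n : V, ‖n‖ = 1 ∧ ∀ z ∈ Ω, inner ℝ n z < inner ℝ n y := by
  obtain ⟨f, hf⟩ := geometric_hahn_banach_open_point hc ho hy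
  set m := (InnerProductSpace.toDual ℝ V).symm f
  have hm (z : V) : inner ℝ m z = f z := InnerProductSpace.toDual_symm_apply
  have hm0 : m ≠ 0 := by
    rintro h
    obtain ⟨x, hx⟩ := hne
    simpa only [← hm, h, inner_zero_left, lt_irrefl] using hf x hx
  refine ⟨‖m‖⁻¹ • m, norm_smul_inv_norm hm0, fun z hz => ?_⟩
  simp only [real_inner_smul_left, hm]
  exact mul_lt_mul_of_pos_left (hf z hz) (inv_pos.2 (norm_pos_iff.2 hm0))

variable [FiniteDimensional ℝ V]

theorem exists_norm_eq_one_forall_inner_lt_add_infDist {Ω : Set V} (hc : Convex ℝ Ω)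
    (ho : IsOpen Ω) (hΩ : Ω ≠ Set.univ) {x : V} (hx : x ∈ Ω) :
    ∃ n : V, ‖n‖ = 1 ∧ ∀ z ∈ Ω, inner ℝ n z < inner ℝ n x + Metric.infDist x Ωᶜ := by
  obtain ⟨y, hy, hxy⟩ :=
    ho.isClosed_compl.exists_infDist_eq_dist (Set.nonempty_compl.2 hΩ) x
  obtain ⟨n, hn, hlt⟩ := exists_norm_eq_one_forall_inner_lt hc ho ⟨x, hx⟩ hy
  refine ⟨n, hn, fun z hz => (hlt z hz).trans_le ?_⟩
  have : inner ℝ n (y - x) ≤ Metric.infDist x Ωᶜ := by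
    simpa only [hxy, hn, one_mul, dist_eq_norm'] using real_inner_le_norm n (y - x)
  linarith [inner_sub_right (𝕜 := ℝ) n y x]

variable [MeasurableSpace V] [BorelSpace V] {F : Type*} [NormedAddCommGroup F] [NormedSpace ℝ F]
  [CompleteSpace F] {μ : Measure V} [μ.IsAddRightInvariant]

/-- The compact support of `v` is covered by finitely many half-spaces containing `Ω`, to which
`lintegral_enorm_le_of_halfspaces` applies. -/
theorem lintegral_enorm_le_of_infDist_compl_lt [SFinite μ] {Ω : Set V} (hc : Convex ℝ Ω)
    (ho : IsOpen Ω) (hΩ : Ω ≠ Set.univ) {K : ℝ} (hK : ∀ x ∈ Ω, Metric.infDist x Ωᶜ < K) {v : V → F}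
    (hv : ContDiff ℝ 1 v) (hcs : HasCompactSupport v) (hs : tsupport v ⊆ Ω) :
    ∫⁻ x, ‖v x‖ₑ ∂μ ≤ ENNReal.ofReal K * ∫⁻ x, ‖fderiv ℝ v x‖ₑ ∂μ := by
  choose! n hn hlt using fun x (hx : x ∈ Ω) =>
    exists_norm_eq_one_forall_inner_lt_add_infDist hc ho hΩ hx
  set c : V → ℝ := fun x => inner ℝ (n x) x + Metric.infDist x Ωᶜ
  have hnhds : ∀ x ∈ tsupport v, {z | c x - inner ℝ (n x) z < K} ∈ 𝓝 x := fun x hx =>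
    (isOpen_lt (by fun_prop) continuous_const).mem_nhds
      (by simpa only [c, Set.mem_ofPred_eq, add_sub_cancel_left] using hK x (hs hx))
  obtain ⟨t, ht, hcover⟩ := hcs.isCompact.elim_nhds_subcover _ hnhds
  have htΩ (i : Fin t.card) : (t.equivFin.symm i : V) ∈ Ω := hs (ht _ (t.equivFin.symm i).2)
  refine lintegral_enorm_le_of_halfspaces (n := fun i => n (t.equivFin.symm i))
    (c := fun i => c (t.equivFin.symm i)) (fun i => hn _ (htΩ i)) hv ?_ ?_
  · intro x i hi
    by_contra hvx
    exact (hlt _ (htΩ i) x (hs (subset_tsupport _ hvx))).not_ge hi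
  · intro x hvx
    obtain ⟨z, hz, hxz⟩ := Set.mem_iUnion₂.1 (hcover (subset_tsupport _ hvx))
    exact ⟨t.equivFin ⟨z, hz⟩, by simpa only [Equiv.symm_apply_apply] using hxz.le⟩

theorem lintegral_enorm_le_of_infDist_compl_le [IsFiniteMeasureOnCompacts μ] {Ω : Set V}
    (hc : Convex ℝ Ω) (ho : IsOpen Ω) (hΩ : Ω ≠ Set.univ) {K : ℝ}
    (hK : ∀ x ∈ Ω, Metric.infDist x Ωᶜ ≤ K) {v : V → F} (hv : ContDiff ℝ 1 v)
    (hcs : HasCompactSupport v) (hs : tsupport v ⊆ Ω) :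
    ∫⁻ x, ‖v x‖ₑ ∂μ ≤ ENNReal.ofReal K * ∫⁻ x, ‖fderiv ℝ v x‖ₑ ∂μ := by
  have hint : Integrable (fderiv ℝ v) μ :=
    (hv.continuous_fderiv one_ne_zero).integrable_of_hasCompactSupport (hcs.fderiv ℝ)
  have hlim : Tendsto (fun K' => ENNReal.ofReal K' * ∫⁻ x, ‖fderiv ℝ v x‖ₑ ∂μ) (𝓝[>] K)
      (𝓝 (ENNReal.ofReal K * ∫⁻ x, ‖fderiv ℝ v x‖ₑ ∂μ)) :=
    ENNReal.Tendsto.mul_const ((ENNReal.continuous_ofReal.tendsto K).mono_left nhdsWithin_le_nhds)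
      (Or.inr hint.2.ne)
  refine ge_of_tendsto hlim (eventually_mem_nhdsWithin.mono fun K' hK' => ?_)
  exact lintegral_enorm_le_of_infDist_compl_lt hc ho hΩ (fun x hx => (hK x hx).trans_lt hK')
    hv hcs hs

theorem setIntegral_norm_le_of_infDist_compl_le [IsFiniteMeasureOnCompacts μ] {Ω : Set V}
    (hc : Convex ℝ Ω) (ho : IsOpen Ω) (hΩ : Ω ≠ Set.univ) {K : ℝ} (hK0 : 0 ≤ K)
    (hK : ∀ x ∈ Ω, Metric.infDist x Ωᶜ ≤ K) {v : V → F} (hv : ContDiff ℝ 1 v)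
    (hcs : HasCompactSupport v) (hs : tsupport v ⊆ Ω) :
    ∫ x in Ω, ‖v x‖ ∂μ ≤ K * ∫ x in Ω, ‖fderiv ℝ v x‖ ∂μ := by
  have hvi : Integrable v μ := hv.continuous.integrable_of_hasCompactSupport hcs
  have hdi : Integrable (fderiv ℝ v) μ :=
    (hv.continuous_fderiv one_ne_zero).integrable_of_hasCompactSupport (hcs.fderiv ℝ)
  have hv0 : ∀ x ∉ Ω, ‖v x‖ = 0 := fun x hx => by
    rw [image_eq_zero_of_notMem_tsupport fun h => hx (hs h), norm_zero]
  have hd0 : ∀ x ∉ Ω, ‖fderiv ℝ v x‖ = 0 := fun x hx => by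
    rw [norm_eq_zero, ← Function.notMem_support]
    exact fun h => hx (hs (support_fderiv_subset ℝ h))
  rw [setIntegral_eq_integral_of_forall_compl_eq_zero hv0,
    setIntegral_eq_integral_of_forall_compl_eq_zero hd0,
    integral_norm_eq_lintegral_enorm hvi.1, integral_norm_eq_lintegral_enorm hdi.1]
  have := ENNReal.toReal_mono (ENNReal.mul_ne_top ENNReal.ofReal_ne_top hdi.2.ne)
    (lintegral_enorm_le_of_infDist_compl_le (μ := μ) hc ho hΩ hK hv hcs hs)
  rwa [ENNReal.toReal_mul, ENNReal.toReal_ofReal hK0] at this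

end LinearIsoperimetry

section UniformConvexity

theorem exists_forall_le_mul_of_isCompact {X : Type*} [TopologicalSpace X] {K : Set X}
    (hK : IsCompact K) {f g : X → ℝ} (hf : Continuous f) (hg : Continuous g)
    (hg0 : ∀ x ∈ K, 0 ≤ g x) (hfg : ∀ x ∈ K, g x = 0 → f x < 0) :
    ∃ C, 0 ≤ C ∧ ∀ x ∈ K, f x ≤ C * g x := by
  have hpos : ∀ x ∈ K ∩ {x | 0 ≤ f x}, 0 < g x := fun x ⟨hxK, hx⟩ =>
    (hg0 x hxK).lt_of_ne' fun h => (hfg x hxK h).not_ge hx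
  obtain ⟨C, hC⟩ := (hK.inter_right (isClosed_le continuous_const hf)).exists_bound_of_continuousOn
    (hf.continuousOn.div hg.continuousOn fun x hx => (hpos x hx).ne')
  refine ⟨max C 0, le_max_right _ _, fun x hx => ?_⟩
  by_cases h : 0 ≤ f x
  · exact (div_le_iff₀ (hpos x ⟨hx, h⟩)).1
      ((Real.le_norm_self _).trans ((hC x ⟨hx, h⟩).trans (le_max_left _ _)))
  · exact (not_le.1 h).le.trans (mul_nonneg (le_max_right _ _) (hg0 x hx))

section MidpointDefect

variable {F : Type*} [NormedAddCommGroup F] {p : ℝ}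

/-- The amount by which `‖·‖ ^ p` at the midpoint of `x` and `y` falls short of the mean of its
values at `x` and `y`; it measures the strict convexity of `‖·‖ ^ p`. -/
noncomputable def midpointDefect (p : ℝ) (x y : F) : ℝ :=
  (‖x‖ ^ p + ‖y‖ ^ p) / 2 - (‖x + y‖ / 2) ^ p

theorem midpointDefect_nonneg (hp : 1 ≤ p) (x y : F) : 0 ≤ midpointDefect p x y := by
  refine sub_nonneg.2 ?_
  calc (‖x + y‖ / 2) ^ p ≤ ((1 / 2) • ‖x‖ + (1 / 2) • ‖y‖) ^ p := by
        gcongr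
        simp only [smul_eq_mul]
        linarith [norm_add_le x y]
    _ ≤ (1 / 2) • ‖x‖ ^ p + (1 / 2) • ‖y‖ ^ p :=
        (convexOn_rpow hp).2 (norm_nonneg x) (norm_nonneg y) one_half_pos.le one_half_pos.le
          (add_halves 1)
    _ = (‖x‖ ^ p + ‖y‖ ^ p) / 2 := by simp only [smul_eq_mul]; ring

theorem continuous_midpointDefect (hp : 0 ≤ p) :
    Continuous fun z : F × F => midpointDefect p z.1 z.2 := by
  unfold midpointDefect
  fun_prop (disch := simp [hp])

variable [NormedSpace ℝ F]

theorem midpointDefect_pos [StrictConvexSpace ℝ F] (hp : 1 < p) {x y : F} (hxy : x ≠ y) :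
    0 < midpointDefect p x y := by
  refine sub_pos.2 ?_
  by_cases hnorm : ‖x‖ = ‖y‖
  · have hlt : ‖x + y‖ < ‖x‖ + ‖y‖ := (norm_add_le x y).lt_of_ne fun h =>
      hxy ((sameRay_iff_of_norm_eq hnorm).1 (sameRay_iff_norm_add.2 h))
    calc (‖x + y‖ / 2) ^ p < ‖x‖ ^ p := by
          gcongr
          linarith
      _ = (‖x‖ ^ p + ‖y‖ ^ p) / 2 := by rw [← hnorm, add_self_div_two]
  · calc (‖x + y‖ / 2) ^ p ≤ ((1 / 2) • ‖x‖ + (1 / 2) • ‖y‖) ^ p := by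
          gcongr
          simp only [smul_eq_mul]
          linarith [norm_add_le x y]
      _ < (1 / 2) • ‖x‖ ^ p + (1 / 2) • ‖y‖ ^ p :=
          (strictConvexOn_rpow hp).2 (norm_nonneg x) (norm_nonneg y) hnorm one_half_pos
            one_half_pos (add_halves 1)
      _ = (‖x‖ ^ p + ‖y‖ ^ p) / 2 := by simp only [smul_eq_mul]; ring

theorem midpointDefect_smul (c : ℝ) (x y : F) :
    midpointDefect p (c • x) (c • y) = |c| ^ p * midpointDefect p x y := by
  rw [midpointDefect, midpointDefect, ← smul_add, norm_smul, norm_smul, norm_smul, mul_div_assoc]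
  simp only [Real.norm_eq_abs, Real.mul_rpow, abs_nonneg, norm_nonneg, div_nonneg, zero_le_two]
  ring

/-- By homogeneity it suffices to find `C` on the unit sphere of `F × F`, which is compact. -/
theorem exists_norm_sub_rpow_le [StrictConvexSpace ℝ F] [FiniteDimensional ℝ F] (hp : 1 < p)
    {ε : ℝ} (hε : 0 < ε) :
    ∃ C, 0 ≤ C ∧ ∀ x y : F,
      ‖x - y‖ ^ p ≤ ε * (‖x‖ ^ p + ‖y‖ ^ p) + C * midpointDefect p x y := by
  have hp0 : 0 < p := one_pos.trans hp
  obtain ⟨C, hC0, hC⟩ : ∃ C, 0 ≤ C ∧ ∀ z ∈ Metric.sphere (0 : F × F) 1,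
      ‖z.1 - z.2‖ ^ p - ε * (‖z.1‖ ^ p + ‖z.2‖ ^ p) ≤ C * midpointDefect p z.1 z.2 := by
    refine exists_forall_le_mul_of_isCompact (isCompact_sphere _ _) ?_
      (continuous_midpointDefect hp0.le) (fun z _ => midpointDefect_nonneg hp.le _ _) ?_
    · fun_prop (disch := simp [hp0.le])
    · rintro ⟨x, y⟩ hz hdefect
      obtain rfl : x = y := by_contra fun hxy => (midpointDefect_pos hp hxy).ne' hdefect
      have hx : ‖x‖ = 1 := by simpa [Prod.norm_def] using hz
      simp [hx, Real.zero_rpow hp0.ne', hε]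
  refine ⟨C, hC0, fun x y => ?_⟩
  by_cases h0 : (x, y) = 0
  · obtain ⟨rfl, rfl⟩ : x = 0 ∧ y = 0 := Prod.mk_eq_zero.1 h0
    simp [midpointDefect, Real.zero_rpow hp0.ne']
  · obtain ⟨r, v, w, hr, hvw, rfl, rfl⟩ : ∃ r : ℝ, ∃ v w : F,
        0 ≤ r ∧ (v, w) ∈ Metric.sphere (0 : F × F) 1 ∧ x = r • v ∧ y = r • w := by
      have hr := norm_ne_zero_iff.2 h0
      refine ⟨_, _, _, norm_nonneg (x, y), ?_, (smul_inv_smul₀ hr x).symm,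
        (smul_inv_smul₀ hr y).symm⟩
      rw [← Prod.smul_mk, mem_sphere_zero_iff_norm, norm_smul, norm_inv, norm_norm,
        inv_mul_cancel₀ hr]
    have hrpow (z : F) : ‖r • z‖ ^ p = r ^ p * ‖z‖ ^ p := by
      rw [norm_smul, Real.norm_of_nonneg hr, Real.mul_rpow hr (norm_nonneg z)]
    rw [← smul_sub, hrpow, hrpow, hrpow, midpointDefect_smul, abs_of_nonneg hr]
    linear_combination r ^ p * hC (v, w) hvw

end MidpointDefect

section Lp

variable {α F : Type*} [MeasurableSpace α] {μ : Measure α} [NormedAddCommGroup F] {p : ENNReal}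

theorem norm_Lp_rpow (hp0 : p ≠ 0) (hp : p ≠ ⊤) (f : Lp F p μ) :
    ‖f‖ ^ p.toReal = ∫ x, ‖f x‖ ^ p.toReal ∂μ := by
  rw [Lp.norm_def, toReal_eLpNorm (Lp.memLp f).1,
    lpNorm_eq_integral_norm_rpow_toReal hp0 hp (Lp.memLp f).1,
    Real.rpow_inv_rpow (integral_nonneg fun x => by positivity) (ENNReal.toReal_pos hp0 hp).ne']

theorem norm_Lp_sub_rpow_le [Fact (1 ≤ p)] (hp : p ≠ ⊤) {ε C : ℝ}
    (h : ∀ x y : F, ‖x - y‖ ^ p.toReal ≤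
      ε * (‖x‖ ^ p.toReal + ‖y‖ ^ p.toReal) + C * midpointDefect p.toReal x y) (f g : Lp F p μ) :
    ‖f - g‖ ^ p.toReal ≤
      ε * (‖f‖ ^ p.toReal + ‖g‖ ^ p.toReal) + C * midpointDefect p.toReal f g := by
  have hp0 : p ≠ 0 := (zero_lt_one.trans_le Fact.out).ne'
  have hint (f : Lp F p μ) : Integrable (fun x => ‖f x‖ ^ p.toReal) μ :=
    (Lp.memLp f).integrable_norm_rpow hp0 hp
  have hsum : Integrable (fun x => ‖f x‖ ^ p.toReal + ‖g x‖ ^ p.toReal) μ := (hint f).add (hint g)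
  have hhalf (h : Lp F p μ) : Integrable (fun x => (‖h x‖ / 2) ^ p.toReal) μ := by
    simpa only [Real.div_rpow (norm_nonneg _) zero_le_two] using (hint h).div_const _
  have hadd : (fun x => (‖(f + g) x‖ / 2) ^ p.toReal) =ᵐ[μ]
      fun x => (‖f x + g x‖ / 2) ^ p.toReal := by
    filter_upwards [Lp.coeFn_add f g] with x hx using by rw [hx, Pi.add_apply]
  have hdefect : Integrable (fun x => midpointDefect p.toReal (f x) (g x)) μ :=
    (hsum.div_const 2).sub ((hhalf (f + g)).congr hadd)
  calc ‖f - g‖ ^ p.toReal = ∫ x, ‖(f - g) x‖ ^ p.toReal ∂μ := norm_Lp_rpow hp0 hp _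
    _ ≤ ∫ x, (ε * (‖f x‖ ^ p.toReal + ‖g x‖ ^ p.toReal) +
          C * midpointDefect p.toReal (f x) (g x)) ∂μ := by
        refine integral_mono_ae (hint _) ((hsum.const_mul ε).add (hdefect.const_mul C)) ?_
        filter_upwards [Lp.coeFn_sub f g] with x hx using by rw [hx]; exact h (f x) (g x)
    _ = ε * ∫ x, (‖f x‖ ^ p.toReal + ‖g x‖ ^ p.toReal) ∂μ +
          C * ∫ x, midpointDefect p.toReal (f x) (g x) ∂μ := by
        rw [integral_add (hsum.const_mul ε) (hdefect.const_mul C), integral_const_mul,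
          integral_const_mul]
    _ = ε * (‖f‖ ^ p.toReal + ‖g‖ ^ p.toReal) + C * midpointDefect p.toReal f g := by
        simp only [midpointDefect]
        rw [integral_sub (hsum.div_const 2) ((hhalf (f + g)).congr hadd), ← integral_congr_ae hadd,
          integral_div, integral_add (hint f) (hint g), ← norm_Lp_rpow hp0 hp,
          ← norm_Lp_rpow hp0 hp]
        simp only [Real.div_rpow (norm_nonneg _) zero_le_two, integral_div, norm_Lp_rpow hp0 hp]

theorem uniformConvexSpace_Lp [NormedSpace ℝ F] [StrictConvexSpace ℝ F] [FiniteDimensional ℝ F]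
    [Fact (1 ≤ p)] (hp1 : 1 < p) (hp : p ≠ ⊤) : UniformConvexSpace (Lp F p μ) where
  uniform_convex ε hε := by
    have hr : 1 < p.toReal := by simpa using ENNReal.toReal_strict_mono hp hp1
    obtain ⟨C, hC0, hC⟩ :=
      exists_norm_sub_rpow_le (F := F) hr (ε := ε ^ p.toReal / 4) (by positivity)
    refine ⟨ε ^ p.toReal / (p.toReal * (C + 1)), by positivity, fun f hf g hg hfg => ?_⟩
    have hdefect : ε ^ p.toReal / 2 ≤ C * (1 - (‖f + g‖ / 2) ^ p.toReal) := by
      have h := norm_Lp_sub_rpow_le hp hC f g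
      have hεr : ε ^ p.toReal ≤ ‖f - g‖ ^ p.toReal := by gcongr
      simp only [midpointDefect, hf, hg, Real.one_rpow] at h
      linarith
    have hbernoulli : 1 + p.toReal * (‖f + g‖ / 2 - 1) ≤ (‖f + g‖ / 2) ^ p.toReal := by
      simpa using one_add_mul_self_le_rpow_one_add (s := ‖f + g‖ / 2 - 1)
        (by linarith [norm_nonneg (f + g)]) hr.le
    have hle : ‖f + g‖ ≤ 2 := by linarith [norm_add_le f g]
    rw [le_sub_iff_add_le, ← le_sub_iff_add_le', div_le_iff₀ (by positivity)]
    nlinarith [mul_le_mul_of_nonneg_left hbernoulli hC0]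

end Lp

section MinimalNorm

variable {X : Type*} [NormedAddCommGroup X] [UniformConvexSpace X]

theorem cauchySeq_of_tendsto_norm_of_le_norm_add [NormedSpace ℝ X] {u : ℕ → X} {d : ℝ}
    (hu : Tendsto (fun n => ‖u n‖) atTop (𝓝 d)) (hd : ∀ m n, 2 * d ≤ ‖u m + u n‖) :
    CauchySeq u := by
  obtain hd0 | hd0 := (ge_of_tendsto' hu fun n => norm_nonneg (u n)).eq_or_lt
  · rw [← hd0] at hu
    exact (tendsto_zero_iff_norm_tendsto_zero.2 hu).cauchySeq
  refine Metric.cauchySeq_iff.2 fun ε hε => ?_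
  obtain ⟨δ, hδ, h⟩ := exists_forall_closed_ball_dist_add_le_two_sub X
    (div_pos hε (mul_pos two_pos hd0))
  obtain ⟨t, ⟨ht2, htδ⟩, hdt⟩ : ∃ t, (t < 2 * d ∧ (2 - δ) * t < 2 * d) ∧ d < t := by
    refine (((?_ : ∀ᶠ t in 𝓝 d, _).filter_mono nhdsWithin_le_nhds).and
      (self_mem_nhdsWithin (s := Set.Ioi d))).exists
    refine (eventually_lt_nhds (by linarith)).and ?_
    refine ((continuous_const_mul (2 - δ)).tendsto d).eventually (eventually_lt_nhds ?_)
    nlinarith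
  have ht0 : 0 < t := hd0.trans hdt
  have hball {x : X} (hx : ‖x‖ < t) : ‖t⁻¹ • x‖ ≤ 1 := by
    rw [norm_smul, norm_inv, Real.norm_of_nonneg ht0.le, inv_mul_le_iff₀ ht0, mul_one]
    exact hx.le
  obtain ⟨N, hN⟩ := eventually_atTop.1 (hu.eventually (eventually_lt_nhds hdt))
  refine ⟨N, fun m hm n hn => lt_of_not_ge fun hdist => (hd m n).not_gt ?_⟩
  have hsep : ε / (2 * d) ≤ ‖t⁻¹ • u m - t⁻¹ • u n‖ := by
    rw [← smul_sub, norm_smul, norm_inv, Real.norm_of_nonneg ht0.le, ← dist_eq_norm,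
      inv_mul_eq_div]
    gcongr
  have hadd := h (hball (hN m hm)) (hball (hN n hn)) hsep
  rw [← smul_add, norm_smul, norm_inv, Real.norm_of_nonneg ht0.le, inv_mul_le_iff₀ ht0] at hadd
  linarith

theorem exists_norm_le_of_convex [NormedSpace ℝ X] [CompleteSpace X] {K : Set X} (hne : K.Nonempty)
    (hcl : IsClosed K) (hc : Convex ℝ K) : ∃ x ∈ K, ∀ y ∈ K, ‖x‖ ≤ ‖y‖ := by
  have hbdd : BddBelow (norm '' K) := ⟨0, Set.forall_mem_image.2 fun x _ => norm_nonneg x⟩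
  have hd {y : X} (hy : y ∈ K) : sInf (norm '' K) ≤ ‖y‖ := csInf_le hbdd ⟨y, hy, rfl⟩
  obtain ⟨r, -, hr, hrK⟩ := exists_seq_tendsto_sInf (hne.image norm) hbdd
  choose u huK hu using hrK
  replace hu : Tendsto (fun n => ‖u n‖) atTop (𝓝 (sInf (norm '' K))) := by
    simpa only [hu] using hr
  have hmid (m n : ℕ) : 2 * sInf (norm '' K) ≤ ‖u m + u n‖ := by
    have h := hd (hc.midpoint_mem (huK m) (huK n))
    rwa [midpoint_eq_smul_add, norm_smul, Real.norm_of_nonneg (by norm_num), invOf_eq_inv,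
      le_inv_mul_iff₀ two_pos] at h
  obtain ⟨x, hx⟩ := cauchySeq_tendsto_of_complete (cauchySeq_of_tendsto_norm_of_le_norm_add hu hmid)
  refine ⟨x, hcl.mem_of_tendsto hx (Eventually.of_forall huK), fun y hy => ?_⟩
  exact (tendsto_nhds_unique hx.norm hu).trans_le (hd hy)

end MinimalNorm

end UniformConvexity

section LpNorm

variable {α F F' : Type*} [MeasurableSpace α] {μ : Measure α} [NormedAddCommGroup F]
  [NormedAddCommGroup F'] {p q : ℝ} {f : α → F} {g : α → F'}

theorem lpNorm_rpow_eq_integral (hp : 0 < p) (hf : AEStronglyMeasurable f μ) :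
    lpNorm f (ENNReal.ofReal p) μ ^ p = ∫ x, ‖f x‖ ^ p ∂μ := by
  rw [lpNorm_eq_integral_norm_rpow_toReal (ENNReal.ofReal_pos.2 hp).ne' ENNReal.ofReal_ne_top hf,
    ENNReal.toReal_ofReal hp.le,
    Real.rpow_inv_rpow (integral_nonneg fun x => by positivity) hp.ne']

theorem lpNorm_eq_integral_rpow (hp : 0 < p) (hf : AEStronglyMeasurable f μ) :
    lpNorm f (ENNReal.ofReal p) μ = (∫ x, ‖f x‖ ^ p ∂μ) ^ (1 / p) := by
  rw [← lpNorm_rpow_eq_integral hp hf, one_div, Real.rpow_rpow_inv lpNorm_nonneg hp.ne']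

theorem integrable_norm_rpow_ofReal (hp : 0 < p) (hf : MemLp f (ENNReal.ofReal p) μ) :
    Integrable (fun x => ‖f x‖ ^ p) μ := by
  simpa only [ENNReal.toReal_ofReal hp.le] using
    hf.integrable_norm_rpow (ENNReal.ofReal_pos.2 hp).ne' ENNReal.ofReal_ne_top

theorem integral_norm_mul_norm_le_lpNorm_mul_lpNorm (hpq : p.HolderConjugate q)
    (hf : MemLp f (ENNReal.ofReal p) μ) (hg : MemLp g (ENNReal.ofReal q) μ) :
    ∫ x, ‖f x‖ * ‖g x‖ ∂μ ≤ lpNorm f (ENNReal.ofReal p) μ * lpNorm g (ENNReal.ofReal q) μ := by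
  rw [lpNorm_eq_integral_rpow hpq.pos hf.1, lpNorm_eq_integral_rpow hpq.symm.pos hg.1]
  exact integral_mul_le_Lp_mul_Lq_of_nonneg hpq (ae_of_all _ fun _ => norm_nonneg _)
    (ae_of_all _ fun _ => norm_nonneg _) hf.norm hg.norm

theorem integral_norm_le_measureReal_rpow_mul_lpNorm [IsFiniteMeasure μ]
    (hpq : p.HolderConjugate q) (hf : MemLp f (ENNReal.ofReal p) μ) :
    ∫ x, ‖f x‖ ∂μ ≤ μ.real Set.univ ^ (1 / q) * lpNorm f (ENNReal.ofReal p) μ := by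
  have h := integral_norm_mul_norm_le_lpNorm_mul_lpNorm (μ := μ) (f := fun _ => (1 : ℝ)) hpq.symm
    (memLp_const 1) hf
  simpa [lpNorm_eq_integral_rpow hpq.symm.pos (aestronglyMeasurable_const (μ := μ) (b := (1 : ℝ)))]
    using h

theorem memLp_norm_rpow_sub_one (hpq : p.HolderConjugate q) (hf : MemLp f (ENNReal.ofReal p) μ) :
    MemLp (fun x => ‖f x‖ ^ (p - 1)) (ENNReal.ofReal q) μ := by
  have h := hf.norm_rpow_div (ENNReal.ofReal (p - 1))
  rwa [ENNReal.toReal_ofReal hpq.sub_one_pos.le, ← ENNReal.ofReal_div_of_pos hpq.sub_one_pos,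
    ← hpq.conjugate_eq] at h

theorem lpNorm_norm_rpow_sub_one (hpq : p.HolderConjugate q) (hf : AEStronglyMeasurable f μ) :
    lpNorm (fun x => ‖f x‖ ^ (p - 1)) (ENNReal.ofReal q) μ =
      lpNorm f (ENNReal.ofReal p) μ ^ (p - 1) := by
  have hmeas : AEStronglyMeasurable (fun x => ‖f x‖ ^ (p - 1)) μ :=
    (hf.norm.aemeasurable.pow_const _).aestronglyMeasurable
  have hpow (x : α) : ‖‖f x‖ ^ (p - 1)‖ ^ q = ‖f x‖ ^ p := by
    rw [Real.norm_of_nonneg (by positivity), ← Real.rpow_mul (norm_nonneg _),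
      hpq.sub_one_mul_conj]
  rw [lpNorm_eq_integral_rpow hpq.symm.pos hmeas]
  simp only [hpow]
  rw [← lpNorm_rpow_eq_integral hpq.pos hf, ← Real.rpow_mul lpNorm_nonneg, mul_one_div,
    hpq.div_conj_eq_sub_one]

theorem integrable_norm_rpow_sub_one_mul_norm (hpq : p.HolderConjugate q)
    (hf : MemLp f (ENNReal.ofReal p) μ) (hg : MemLp g (ENNReal.ofReal p) μ) :
    Integrable (fun x => ‖f x‖ ^ (p - 1) * ‖g x‖) μ :=
  have := hpq.symm.ennrealOfReal
  (memLp_norm_rpow_sub_one hpq hf).integrable_mul hg.norm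

theorem integral_norm_rpow_sub_one_mul_norm_le (hpq : p.HolderConjugate q)
    (hf : MemLp f (ENNReal.ofReal p) μ) (hg : MemLp g (ENNReal.ofReal p) μ) :
    ∫ x, ‖f x‖ ^ (p - 1) * ‖g x‖ ∂μ ≤
      lpNorm f (ENNReal.ofReal p) μ ^ (p - 1) * lpNorm g (ENNReal.ofReal p) μ := by
  rw [← lpNorm_norm_rpow_sub_one hpq hf.1]
  have h := integral_norm_mul_norm_le_lpNorm_mul_lpNorm hpq.symm (memLp_norm_rpow_sub_one hpq hf) hg
  simpa only [Real.norm_of_nonneg (Real.rpow_nonneg (norm_nonneg _) _)] using h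

theorem norm_toLp_eq_lpNorm {α F : Type*} [MeasurableSpace α] {μ : Measure α}
    [NormedAddCommGroup F] {r : ENNReal} {f : α → F} (hf : MemLp f r μ) :
    ‖hf.toLp f‖ = lpNorm f r μ := by
  rw [Lp.norm_toLp, toReal_eLpNorm hf.1]

end LpNorm

section Poincare

variable {V F : Type*} [NormedAddCommGroup V] [InnerProductSpace ℝ V] [MeasurableSpace V]
  {ν : Measure V} [NormedAddCommGroup F] [InnerProductSpace ℝ F] {p q : ℝ} {v : V → F}

theorem integral_norm_fderiv_norm_rpow_le (hpq : p.HolderConjugate q) (hv : Differentiable ℝ v)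
    (hvp : MemLp v (ENNReal.ofReal p) ν) (hdp : MemLp (fderiv ℝ v) (ENNReal.ofReal p) ν) :
    ∫ x, ‖fderiv ℝ (fun x => ‖v x‖ ^ p) x‖ ∂ν ≤
      p * ∫ x, ‖v x‖ ^ (p - 1) * ‖fderiv ℝ v x‖ ∂ν := by
  rw [← integral_const_mul]
  refine integral_mono_of_nonneg (ae_of_all _ fun _ => norm_nonneg _)
    ((integrable_norm_rpow_sub_one_mul_norm hpq hvp hdp).const_mul p) (ae_of_all _ fun x => ?_)
  simpa only [mul_assoc] using norm_fderiv_norm_rpow_le hv (x := x) hpq.lt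

variable [FiniteDimensional ℝ V] [BorelSpace V] {μ : Measure V} [μ.IsAddRightInvariant]
  [IsFiniteMeasureOnCompacts μ] {Ω : Set V} {K : ℝ}

theorem lpNorm_le_of_infDist_compl_le (hc : Convex ℝ Ω) (ho : IsOpen Ω) (hΩ : Ω ≠ Set.univ)
    (hK0 : 0 ≤ K) (hK : ∀ x ∈ Ω, Metric.infDist x Ωᶜ ≤ K) (hp : 1 < p) (hv : ContDiff ℝ 1 v)
    (hcs : HasCompactSupport v) (hs : tsupport v ⊆ Ω) :
    lpNorm v (ENNReal.ofReal p) (μ.restrict Ω) ≤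
      K * p * lpNorm (fderiv ℝ v) (ENNReal.ofReal p) (μ.restrict Ω) := by
  have hp0 : 0 < p := one_pos.trans hp
  have hpq := Real.HolderConjugate.conjExponent hp
  have hvp : MemLp v (ENNReal.ofReal p) (μ.restrict Ω) :=
    (hv.continuous.memLp_of_hasCompactSupport hcs).restrict Ω
  have hdp : MemLp (fderiv ℝ v) (ENNReal.ofReal p) (μ.restrict Ω) :=
    ((hv.continuous_fderiv one_ne_zero).memLp_of_hasCompactSupport (hcs.fderiv ℝ)).restrict Ω
  have hsupp : Function.support (fun x => ‖v x‖ ^ p) ⊆ Function.support v := fun x hx h0 =>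
    hx (by simp only [h0, norm_zero, Real.zero_rpow hp0.ne'])
  have hL1 : ∫ x in Ω, ‖v x‖ ^ p ∂μ ≤ K * ∫ x in Ω, ‖fderiv ℝ (fun x => ‖v x‖ ^ p) x‖ ∂μ := by
    simpa only [Real.norm_of_nonneg (Real.rpow_nonneg (norm_nonneg _) p)] using
      setIntegral_norm_le_of_infDist_compl_le (μ := μ) hc ho hΩ hK0 hK (hv.norm_rpow hp)
        (hcs.mono hsupp) ((closure_mono hsupp).trans hs)
  set N := lpNorm v (ENNReal.ofReal p) (μ.restrict Ω)
  have hN0 : 0 ≤ N := lpNorm_nonneg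
  obtain hN | hN := hN0.eq_or_lt
  · rw [← hN]
    exact mul_nonneg (mul_nonneg hK0 hp0.le) lpNorm_nonneg
  refine le_of_mul_le_mul_left ?_ (Real.rpow_pos_of_pos hN (p - 1))
  calc N ^ (p - 1) * N = ∫ x in Ω, ‖v x‖ ^ p ∂μ := by
        rw [← Real.rpow_add_one hN.ne', sub_add_cancel, lpNorm_rpow_eq_integral hp0 hvp.1]
    _ ≤ K * (p * (N ^ (p - 1) * lpNorm (fderiv ℝ v) (ENNReal.ofReal p) (μ.restrict Ω))) := by
        grw [hL1, integral_norm_fderiv_norm_rpow_le hpq (hv.differentiable one_ne_zero) hvp hdp,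
          integral_norm_rpow_sub_one_mul_norm_le hpq hvp hdp]
    _ = _ := by ring

end Poincare

section Gradient

variable {V : Type*} [NormedAddCommGroup V] [InnerProductSpace ℝ V] [CompleteSpace V]
  {f g : V → ℝ} {x : V}

theorem norm_gradient : ‖gradient f x‖ = ‖fderiv ℝ f x‖ :=
  LinearIsometryEquiv.norm_map _ _

theorem gradient_add (hf : DifferentiableAt ℝ f x) (hg : DifferentiableAt ℝ g x) :
    gradient (f + g) x = gradient f x + gradient g x := by
  rw [gradient, fderiv_add hf hg, map_add, gradient, gradient]

theorem gradient_const_smul (hf : DifferentiableAt ℝ f x) (c : ℝ) :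
    gradient (c • f) x = c • gradient f x := by
  rw [gradient, fderiv_const_smul hf, map_smul, gradient]

theorem continuous_gradient (hf : ContDiff ℝ 1 f) : Continuous (gradient f) :=
  (InnerProductSpace.toDual ℝ V).symm.continuous.comp (hf.continuous_fderiv one_ne_zero)

theorem support_gradient_subset : Function.support (gradient f) ⊆ tsupport f := fun _ hx =>
  support_fderiv_subset ℝ fun h0 => hx (by rw [gradient, h0, map_zero])

theorem hasCompactSupport_gradient (hf : HasCompactSupport f) : HasCompactSupport (gradient f) :=
  (hf.fderiv ℝ).comp_left (g := (InnerProductSpace.toDual ℝ V).symm) (map_zero _)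

theorem integral_smul_gradient_eq_neg [FiniteDimensional ℝ V] [MeasurableSpace V] [BorelSpace V]
    {μ : Measure V} [μ.IsAddHaarMeasure] (hf : ContDiff ℝ 1 f) (hg : ContDiff ℝ 1 g)
    (hfs : HasCompactSupport f) (hgs : HasCompactSupport g) :
    ∫ x, f x • gradient g x ∂μ = -∫ x, g x • gradient f x ∂μ := by
  have hfg : Integrable (fun x => f x • gradient g x) μ :=
    (hf.continuous.smul (continuous_gradient hg)).integrable_of_hasCompactSupport hfs.smul_right
  have hgf : Integrable (fun x => g x • gradient f x) μ :=
    (hg.continuous.smul (continuous_gradient hf)).integrable_of_hasCompactSupport hgs.smul_right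
  have hfg_inner (w x : V) : inner ℝ w (f x • gradient g x) = f x * fderiv ℝ g x w := by
    rw [inner_smul_right, real_inner_comm, inner_gradient_left]
  have hgf_inner (w x : V) : inner ℝ w (g x • gradient f x) = fderiv ℝ f x w * g x := by
    rw [inner_smul_right, real_inner_comm, inner_gradient_left, mul_comm]
  refine ext_inner_left ℝ fun w => ?_
  rw [inner_neg_right, ← integral_inner hfg, ← integral_inner hgf]
  simp only [hfg_inner, hgf_inner]
  refine integral_mul_fderiv_eq_neg_fderiv_mul_of_integrable ?_ ?_ ?_
    (fun x _ => hf.differentiable one_ne_zero x) (fun x _ => hg.differentiable one_ne_zero x)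
  · simpa only [hgf_inner] using hgf.const_inner (𝕜 := ℝ) w
  · simpa only [hfg_inner] using hfg.const_inner (𝕜 := ℝ) w
  · exact (hf.continuous.mul hg.continuous).integrable_of_hasCompactSupport hfs.mul_right

end Gradient

section TestFunction

variable {D : ℕ} {Ω : Set (E D)} {φ ψ : E D → ℝ}

theorem IsTestFunction.contDiff_one (h : IsTestFunction Ω φ) : ContDiff ℝ 1 φ :=
  h.smooth.of_le (by exact_mod_cast le_top)

theorem IsTestFunction.differentiable (h : IsTestFunction Ω φ) : Differentiable ℝ φ :=
  h.contDiff_one.differentiable one_ne_zero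

theorem IsTestFunction.eq_zero (h : IsTestFunction Ω φ) {x : E D} (hx : x ∉ Ω) : φ x = 0 :=
  image_eq_zero_of_notMem_tsupport fun hx' => hx (h.support hx')

theorem IsTestFunction.setIntegral_eq (h : IsTestFunction Ω φ) : ∫ x in Ω, φ x = ∫ x, φ x :=
  setIntegral_eq_integral_of_forall_compl_eq_zero fun _ => h.eq_zero

theorem IsTestFunction.memLp (h : IsTestFunction Ω φ) (r : ENNReal) :
    MemLp φ r (volume.restrict Ω) :=
  (h.smooth.continuous.memLp_of_hasCompactSupport h.compact).restrict Ω

theorem IsTestFunction.memLp_gradient (h : IsTestFunction Ω φ) (r : ENNReal) :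
    MemLp (gradient φ) r (volume.restrict Ω) :=
  ((continuous_gradient h.contDiff_one).memLp_of_hasCompactSupport
    (hasCompactSupport_gradient h.compact)).restrict Ω

theorem IsTestFunction.isWeakGradient (h : IsTestFunction Ω φ) :
    IsWeakGradient Ω φ (gradient φ) := by
  intro ψ hψ
  rw [setIntegral_eq_integral_of_forall_compl_eq_zero
      (fun x hx => by rw [h.eq_zero hx, zero_smul]),
    setIntegral_eq_integral_of_forall_compl_eq_zero
      (fun x hx => by rw [hψ.eq_zero hx, zero_smul])]
  exact integral_smul_gradient_eq_neg h.contDiff_one hψ.contDiff_one h.compact hψ.compact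

/-- The space `C_c^∞(Ω)` of test functions. -/
def testFunctions (Ω : Set (E D)) : Submodule ℝ (E D → ℝ) where
  carrier := {φ | IsTestFunction Ω φ}
  zero_mem' := ⟨contDiff_const, HasCompactSupport.zero, by simp [tsupport]⟩
  add_mem' {φ ψ} hφ hψ := ⟨hφ.smooth.add hψ.smooth, hφ.compact.add hψ.compact,
    (tsupport_add φ ψ).trans (Set.union_subset hφ.support hψ.support)⟩
  smul_mem' c φ hφ := ⟨contDiff_const.smul hφ.smooth, hφ.compact.smul_left,
    (closure_mono (Function.support_const_smul_subset c φ)).trans hφ.support⟩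

theorem mem_testFunctions : φ ∈ testFunctions Ω ↔ IsTestFunction Ω φ := Iff.rfl

theorem IsTestFunction.const_smul (h : IsTestFunction Ω φ) (c : ℝ) : IsTestFunction Ω (c • φ) :=
  (testFunctions Ω).smul_mem c h

end TestFunction

section Pairing

variable {α F F' F'' : Type*} [MeasurableSpace α] {μ : Measure α} [NormedAddCommGroup F]
  [NormedSpace ℝ F] [NormedAddCommGroup F'] [NormedSpace ℝ F'] [NormedAddCommGroup F'']
  [NormedSpace ℝ F''] [CompleteSpace F''] {r s : ENNReal} [Fact (1 ≤ r)]

theorem continuous_integral_bilin [r.HolderConjugate s] (B : F →L[ℝ] F' →L[ℝ] F'') {g : α → F'}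
    (hg : MemLp g s μ) : Continuous fun f : Lp F r μ => ∫ x, B (f x) (g x) ∂μ := by
  have : Fact (1 ≤ s) := ⟨ENNReal.HolderConjugate.one_le s r⟩
  refine ((B.lpPairing μ r s).flip (hg.toLp g)).continuous.congr fun f => ?_
  rw [ContinuousLinearMap.flip_apply, ContinuousLinearMap.lpPairing_eq_integral]
  refine integral_congr_ae ?_
  filter_upwards [hg.coeFn_toLp] with x hx
  rw [hx]

theorem continuous_integral_Lp [IsFiniteMeasure μ] :
    Continuous fun f : Lp F'' r μ => ∫ x, f x ∂μ := by
  have := ENNReal.HolderConjugate.conjExponent (Fact.out : 1 ≤ r)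
  simpa using continuous_integral_bilin (r := r) (ContinuousLinearMap.lsmul ℝ ℝ (E := F'')).flip
    (memLp_const (1 : ℝ) : MemLp (fun _ : α => (1 : ℝ)) r.conjExponent μ)

end Pairing

section Sobolev

variable {D : ℕ} {Ω : Set (E D)} {r : ENNReal} {φ u : E D → ℝ} {G : E D → E D}

/-- The graph map `φ ↦ (φ, ∇φ)` from `C_c^∞(Ω)` to `L^r(Ω) × L^r(Ω; ℝ^D)`. -/
noncomputable def testGraph (r : ENNReal) (Ω : Set (E D)) :
    testFunctions Ω →ₗ[ℝ] Lp ℝ r (volume.restrict Ω) × Lp (E D) r (volume.restrict Ω) where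
  toFun φ := (((mem_testFunctions.1 φ.2).memLp r).toLp _,
    ((mem_testFunctions.1 φ.2).memLp_gradient r).toLp _)
  map_add' φ ψ := by
    have hφ := mem_testFunctions.1 φ.2
    have hψ := mem_testFunctions.1 ψ.2
    have hsum := mem_testFunctions.1 (φ + ψ).2
    refine Prod.ext rfl (MemLp.toLp_congr (hsum.memLp_gradient r)
      ((hφ.memLp_gradient r).add (hψ.memLp_gradient r)) (ae_of_all _ fun x => ?_))
    exact gradient_add (hφ.differentiable x) (hψ.differentiable x)
  map_smul' c φ := by
    have hφ := mem_testFunctions.1 φ.2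
    have hsmul := mem_testFunctions.1 (c • φ).2
    refine Prod.ext rfl (MemLp.toLp_congr (hsmul.memLp_gradient r)
      ((hφ.memLp_gradient r).const_smul c) (ae_of_all _ fun x => ?_))
    exact gradient_const_smul (hφ.differentiable x) c

variable [Fact (1 ≤ r)]

/-- The Sobolev space `W_0^{1,r}(Ω)`, encoded by the graph of the weak gradient: the closure in
`L^r(Ω) × L^r(Ω; ℝ^D)` of the pairs `(φ, ∇φ)` with `φ` a test function. -/
noncomputable def sobolevZero (r : ENNReal) [Fact (1 ≤ r)] (Ω : Set (E D)) :
    Submodule ℝ (Lp ℝ r (volume.restrict Ω) × Lp (E D) r (volume.restrict Ω)) :=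
  (LinearMap.range (testGraph r Ω)).topologicalClosure

theorem IsTestFunction.mem_sobolevZero (h : IsTestFunction Ω φ) :
    ((h.memLp r).toLp φ, (h.memLp_gradient r).toLp (gradient φ)) ∈ sobolevZero r Ω :=
  Submodule.le_topologicalClosure _ ⟨⟨φ, h⟩, rfl⟩

theorem sobolevZero_induction
    {P : Lp ℝ r (volume.restrict Ω) × Lp (E D) r (volume.restrict Ω) → Prop}
    (hP : IsClosed {w | P w})
    (h : ∀ φ (hφ : IsTestFunction Ω φ),
      P ((hφ.memLp r).toLp φ, (hφ.memLp_gradient r).toLp (gradient φ)))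
    {w} (hw : w ∈ sobolevZero r Ω) : P w := by
  have hrange : (LinearMap.range (testGraph r Ω) : Set _) ⊆ {w | P w} := by
    rintro _ ⟨φ, rfl⟩
    exact h φ φ.2
  exact closure_minimal hrange hP hw

theorem IsWeakGradient.congr {u' : E D → ℝ} {G' : E D → E D} (h : IsWeakGradient Ω u G)
    (hu : u =ᵐ[volume.restrict Ω] u') (hG : G =ᵐ[volume.restrict Ω] G') :
    IsWeakGradient Ω u' G' := fun φ hφ => by
  have hint := h φ hφ
  rwa [integral_congr_ae (hu.smul (ae_eq_refl (gradient φ))),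
    integral_congr_ae ((ae_eq_refl φ).smul hG)] at hint

theorem isWeakGradient_of_mem_sobolevZero {w} (hw : w ∈ sobolevZero r Ω) :
    IsWeakGradient Ω w.1 w.2 := by
  have := ENNReal.HolderConjugate.conjExponent (Fact.out : 1 ≤ r)
  intro ψ hψ
  refine sobolevZero_induction (P := fun w => ∫ x in Ω, w.1 x • gradient ψ x =
    -∫ x in Ω, ψ x • w.2 x) ?_ (fun φ hφ => ?_) hw
  · exact isClosed_eq ((continuous_integral_bilin (ContinuousLinearMap.lsmul ℝ ℝ)
      (hψ.memLp_gradient r.conjExponent)).comp continuous_fst)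
      ((continuous_integral_bilin (ContinuousLinearMap.lsmul ℝ ℝ (E := E D)).flip
      (hψ.memLp r.conjExponent)).comp continuous_snd).neg
  · exact hφ.isWeakGradient.congr (hφ.memLp r).coeFn_toLp.symm
      (hφ.memLp_gradient r).coeFn_toLp.symm ψ hψ

end Sobolev

section MemW01p

variable {D : ℕ} {Ω : Set (E D)} {p : ℝ} [Fact (1 ≤ ENNReal.ofReal p)] {u : E D → ℝ}
  {G : E D → E D}

theorem MemW01p.mem_sobolevZero (h : MemW01p p Ω u G) :
    (h.memLp.toLp u, h.memLp_grad.toLp G) ∈ sobolevZero (ENNReal.ofReal p) Ω := by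
  obtain ⟨φ, hφ, hφu, hφG⟩ := h.approx
  refine (Submodule.isClosed_topologicalClosure _).mem_of_tendsto (Tendsto.prodMk_nhds
    ((Lp.tendsto_Lp_iff_tendsto_eLpNorm'' φ (fun n => (hφ n).memLp _) u h.memLp).2 hφu)
    ((Lp.tendsto_Lp_iff_tendsto_eLpNorm'' _ (fun n => (hφ n).memLp_gradient _) G
      h.memLp_grad).2 hφG)) (Eventually.of_forall fun n => (hφ n).mem_sobolevZero)

theorem memW01p_of_mem_sobolevZero {w} (hw : w ∈ sobolevZero (ENNReal.ofReal p) Ω) :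
    MemW01p p Ω w.1 w.2 := by
  obtain ⟨s, hs, hlim⟩ := mem_closure_iff_seq_limit.1 hw
  choose φ hφ using hs
  obtain rfl : (fun n => testGraph _ Ω (φ n)) = s := funext hφ
  refine ⟨⟨Lp.memLp _, Lp.memLp _, isWeakGradient_of_mem_sobolevZero hw⟩,
    fun n => φ n, fun n => (φ n).2, ?_, ?_⟩
  · refine (Lp.tendsto_Lp_iff_tendsto_eLpNorm'' _ (fun n => ?_) _ (Lp.memLp w.1)).1 ?_
    · exact (mem_testFunctions.1 (φ n).2).memLp _
    · rw [Lp.toLp_coeFn]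
      exact (continuous_fst.tendsto w).comp hlim
  · refine (Lp.tendsto_Lp_iff_tendsto_eLpNorm'' _ (fun n => ?_) _ (Lp.memLp w.2)).1 ?_
    · exact (mem_testFunctions.1 (φ n).2).memLp_gradient _
    · rw [Lp.toLp_coeFn]
      exact (continuous_snd.tendsto w).comp hlim

end MemW01p

section MinimalNorm

variable {X Y : Type*} [NormedAddCommGroup X] [CompleteSpace X] [NormedAddCommGroup Y]
  [CompleteSpace Y]

theorem isClosed_image_snd_of_norm_fst_le {A : Set (X × Y)} (hA : IsClosed A) {K : ℝ}
    (hK : ∀ w ∈ A, ∀ z ∈ A, ‖w.1 - z.1‖ ≤ K * ‖w.2 - z.2‖) : IsClosed (Prod.snd '' A) := by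
  have := hA.completeSpace_coe
  have hanti : AntilipschitzWith (max K.toNNReal 1) (fun w : A => w.1.2) := by
    refine AntilipschitzWith.of_le_mul_dist fun w z => ?_
    rw [Subtype.dist_eq, Prod.dist_eq, NNReal.coe_max, max_mul_of_nonneg _ _ dist_nonneg,
      NNReal.coe_one, one_mul]
    refine max_le_max_right _ ?_
    rw [dist_eq_norm, dist_eq_norm]
    grw [hK w w.2 z z.2, ← Real.le_coe_toNNReal K]
  rw [Set.image_eq_range]
  exact hanti.isClosed_range (uniformContinuous_snd.comp uniformContinuous_subtype_val)

theorem exists_norm_snd_le [NormedSpace ℝ X] [NormedSpace ℝ Y] [UniformConvexSpace Y]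
    (S : Submodule ℝ (X × Y)) (hS : IsClosed (S : Set (X × Y))) {K : ℝ}
    (hK : ∀ w ∈ S, ‖w.1‖ ≤ K * ‖w.2‖) (ℓ : X →L[ℝ] ℝ) (hℓ : ∃ w ∈ S, ℓ w.1 = 1) :
    ∃ w ∈ S, ℓ w.1 = 1 ∧ ∀ z ∈ S, ℓ z.1 = 1 → ‖w.2‖ ≤ ‖z.2‖ := by
  set A : Set (X × Y) := S ∩ {w | ℓ w.1 = 1}
  have hA : IsClosed A := hS.inter (isClosed_eq (ℓ.continuous.comp continuous_fst) continuous_const)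
  have hconv : Convex ℝ A := S.convex.inter <|
    (convex_singleton (1 : ℝ)).is_linear_preimage (ℓ.comp (.fst ℝ X Y)).isLinear
  obtain ⟨_, ⟨w, hw, rfl⟩, hmin⟩ := exists_norm_le_of_convex (Set.Nonempty.image Prod.snd hℓ)
    (isClosed_image_snd_of_norm_fst_le hA fun w hw z hz => hK (w - z) (S.sub_mem hw.1 hz.1))
    (hconv.linear_image (LinearMap.snd ℝ X Y))
  exact ⟨w, hw.1, hw.2, fun z hz hz1 => hmin _ ⟨z, ⟨hz, hz1⟩, rfl⟩⟩

end MinimalNorm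

section EulerLagrange

variable {F : Type*} [NormedAddCommGroup F] [InnerProductSpace ℝ F] {p q : ℝ}

theorem norm_rpow_sub_two_mul_inner_self (hp : p ≠ 0) (x : F) :
    ‖x‖ ^ (p - 2) * inner ℝ x x = ‖x‖ ^ p := by
  obtain rfl | hx := eq_or_ne x 0
  · rw [inner_zero_left, mul_zero, norm_zero, Real.zero_rpow hp]
  · rw [real_inner_self_eq_norm_sq, ← Real.rpow_natCast, ← Real.rpow_add (norm_pos_iff.2 hx),
      Nat.cast_ofNat, sub_add_cancel]

theorem abs_norm_rpow_sub_two_mul_inner_le (x y : F) :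
    |‖x‖ ^ (p - 2) * inner ℝ x y| ≤ ‖x‖ ^ (p - 1) * ‖y‖ := by
  obtain rfl | hx := eq_or_ne x 0
  · rw [inner_zero_left, mul_zero, abs_zero]
    positivity
  · calc |‖x‖ ^ (p - 2) * inner ℝ x y| = ‖x‖ ^ (p - 2) * |inner ℝ x y| := by
          rw [abs_mul, abs_of_nonneg (by positivity)]
      _ ≤ ‖x‖ ^ (p - 2) * (‖x‖ * ‖y‖) := by
          gcongr
          exact abs_real_inner_le_norm x y
      _ = ‖x‖ ^ (p - 1) * ‖y‖ := by
          rw [← mul_assoc, ← Real.rpow_add_one (norm_ne_zero_iff.2 hx)]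
          ring_nf

theorem norm_smul_rpow_sub_two_mul_inner_smul {c : ℝ} (hc : 0 < c) (x y : F) :
    ‖c • x‖ ^ (p - 2) * inner ℝ (c • x) y = c ^ (p - 1) * (‖x‖ ^ (p - 2) * inner ℝ x y) := by
  have hpow : c ^ (p - 1) = c ^ (p - 2) * c := by
    rw [← Real.rpow_add_one hc.ne']
    ring_nf
  rw [norm_smul, Real.norm_of_nonneg hc.le, Real.mul_rpow hc.le (norm_nonneg _),
    real_inner_smul_left, hpow]
  ring

variable {α : Type*} [MeasurableSpace α] {μ : Measure α} {G H : α → F}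

theorem integrable_norm_rpow_sub_two_mul_inner (hpq : p.HolderConjugate q)
    (hG : MemLp G (ENNReal.ofReal p) μ) (hH : MemLp H (ENNReal.ofReal p) μ) :
    Integrable (fun x => ‖G x‖ ^ (p - 2) * inner ℝ (G x) (H x)) μ :=
  (integrable_norm_rpow_sub_one_mul_norm hpq hG hH).mono'
    ((hG.1.norm.aemeasurable.pow_const _).aestronglyMeasurable.mul (hG.1.inner hH.1))
    (ae_of_all _ fun _ => abs_norm_rpow_sub_two_mul_inner_le _ _)

theorem abs_integral_norm_rpow_sub_two_mul_inner_le (hpq : p.HolderConjugate q)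
    (hG : MemLp G (ENNReal.ofReal p) μ) (hH : MemLp H (ENNReal.ofReal p) μ) :
    |∫ x, ‖G x‖ ^ (p - 2) * inner ℝ (G x) (H x) ∂μ| ≤
      lpNorm G (ENNReal.ofReal p) μ ^ (p - 1) * lpNorm H (ENNReal.ofReal p) μ :=
  calc |∫ x, ‖G x‖ ^ (p - 2) * inner ℝ (G x) (H x) ∂μ|
      ≤ ∫ x, |‖G x‖ ^ (p - 2) * inner ℝ (G x) (H x)| ∂μ := abs_integral_le_integral_abs
    _ ≤ ∫ x, ‖G x‖ ^ (p - 1) * ‖H x‖ ∂μ :=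
        integral_mono (integrable_norm_rpow_sub_two_mul_inner hpq hG hH).abs
          (integrable_norm_rpow_sub_one_mul_norm hpq hG hH)
          fun _ => abs_norm_rpow_sub_two_mul_inner_le _ _
    _ ≤ _ := integral_norm_rpow_sub_one_mul_norm_le hpq hG hH

theorem hasDerivAt_norm_add_smul_rpow (hp : 1 < p) (x y : F) (t : ℝ) :
    HasDerivAt (fun t : ℝ => ‖x + t • y‖ ^ p)
      (p * (‖x + t • y‖ ^ (p - 2) * inner ℝ (x + t • y) y)) t := by
  have hline : HasDerivAt (fun t : ℝ => x + t • y) y t := by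
    simpa using ((hasDerivAt_id t).smul_const y).const_add x
  convert! (hasFDerivAt_norm_rpow (x + t • y) hp).comp_hasDerivAt t hline using 1
  rw [smul_apply, innerSL_apply_apply, smul_eq_mul, mul_assoc]

theorem hasDerivAt_integral_norm_add_smul_rpow (hpq : p.HolderConjugate q)
    (hG : MemLp G (ENNReal.ofReal p) μ) (hH : MemLp H (ENNReal.ofReal p) μ) :
    HasDerivAt (fun t : ℝ => ∫ x, ‖G x + t • H x‖ ^ p ∂μ)
      (p * ∫ x, ‖G x‖ ^ (p - 2) * inner ℝ (G x) (H x) ∂μ) 0 := by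
  have hmem (t : ℝ) : MemLp (fun x => G x + t • H x) (ENNReal.ofReal p) μ :=
    hG.add (hH.const_smul t)
  have hbound (x : α) (t : ℝ) (ht : t ∈ Metric.ball (0 : ℝ) 1) :
      ‖p * (‖G x + t • H x‖ ^ (p - 2) * inner ℝ (G x + t • H x) (H x))‖ ≤
        p * (‖‖G x‖ + ‖H x‖‖ ^ (p - 1) * ‖H x‖) := by
    have ht1 : ‖t‖ ≤ 1 := (mem_ball_zero_iff.1 ht).le
    have hle : ‖G x + t • H x‖ ≤ ‖‖G x‖ + ‖H x‖‖ := by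
      rw [Real.norm_of_nonneg (by positivity)]
      grw [norm_add_le, norm_smul, ht1, one_mul]
    rw [norm_mul, Real.norm_of_nonneg hpq.nonneg, Real.norm_eq_abs]
    have := hpq.nonneg
    have := hpq.sub_one_pos.le
    grw [abs_norm_rpow_sub_two_mul_inner_le, hle]
  have hder := (hasDerivAt_integral_of_dominated_loc_of_deriv_le (Metric.ball_mem_nhds 0 one_pos)
    (Eventually.of_forall fun t => (integrable_norm_rpow_ofReal hpq.pos (hmem t)).1)
    (integrable_norm_rpow_ofReal hpq.pos (hmem 0))
    ((integrable_norm_rpow_sub_two_mul_inner hpq (hmem 0) hH).const_mul p).1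
    (ae_of_all _ hbound)
    ((integrable_norm_rpow_sub_one_mul_norm hpq (hG.norm.add hH.norm) hH).const_mul p)
    (ae_of_all _ fun x t _ => hasDerivAt_norm_add_smul_rpow hpq.lt (G x) (H x) t)).2
  simpa only [zero_smul, add_zero, integral_const_mul] using hder

theorem integral_norm_rpow_sub_two_mul_inner_eq_zero [Fact (1 ≤ ENNReal.ofReal p)]
    (hpq : p.HolderConjugate q) {g h : Lp F (ENNReal.ofReal p) μ}
    (hmin : ∀ t : ℝ, ‖g‖ ≤ ‖g + t • h‖) :
    ∫ x, ‖g x‖ ^ (p - 2) * inner ℝ (g x) (h x) ∂μ = 0 := by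
  have henergy (t : ℝ) : ∫ x, ‖g x + t • h x‖ ^ p ∂μ = ‖g + t • h‖ ^ p := by
    have hp := norm_Lp_rpow (ENNReal.ofReal_pos.2 hpq.pos).ne' ENNReal.ofReal_ne_top (g + t • h)
    rw [ENNReal.toReal_ofReal hpq.nonneg] at hp
    rw [hp]
    refine integral_congr_ae ?_
    filter_upwards [Lp.coeFn_add g (t • h), Lp.coeFn_smul t h] with x hadd hsmul
    rw [hadd, Pi.add_apply, hsmul, Pi.smul_apply]
  have hder := hasDerivAt_integral_norm_add_smul_rpow hpq (Lp.memLp g) (Lp.memLp h)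
  simp only [henergy] at hder
  have hlocal : IsLocalMin (fun t : ℝ => ‖g + t • h‖ ^ p) 0 := Eventually.of_forall fun t => by
    simpa using Real.rpow_le_rpow (norm_nonneg _) (hmin t) hpq.nonneg
  exact (mul_eq_zero.1 (hlocal.hasDerivAt_eq_zero hder)).resolve_left hpq.pos.ne'

end EulerLagrange

section TorsionConst

variable {D : ℕ} {p C : ℝ} {Ω : Set (E D)} {u : E D → ℝ} {G : E D → E D}

/-- `C` is an admissible constant in the inequality `|∫ φ| ≤ C ‖∇φ‖_p` for test functions. -/
def IsTorsionBound (p : ℝ) (Ω : Set (E D)) (C : ℝ) : Prop :=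
  0 ≤ C ∧ ∀ φ : E D → ℝ, IsTestFunction Ω φ →
    |∫ x in Ω, φ x| ≤ C * lpNorm (gradient φ) (ENNReal.ofReal p) (volume.restrict Ω)

/-- The best constant in `|∫ φ| ≤ C ‖∇φ‖_p`, that is, the norm of the functional `u ↦ ∫ u` on
`W_0^{1,p}(Ω)`; it is `0` if no constant is admissible. -/
noncomputable def torsionConst (p : ℝ) (Ω : Set (E D)) : ℝ := sInf {C | IsTorsionBound p Ω C}

theorem torsionConst_le (h : IsTorsionBound p Ω C) : torsionConst p Ω ≤ C :=
  csInf_le ⟨0, fun _ h => h.1⟩ h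

theorem IsTorsionBound.torsionConst (h : IsTorsionBound p Ω C) :
    IsTorsionBound p Ω (torsionConst p Ω) := by
  refine ⟨le_csInf ⟨C, h⟩ fun _ h => h.1, fun φ hφ => ?_⟩
  rcases (lpNorm_nonneg (f := gradient φ)).eq_or_lt with h0 | h0
  · have := h.2 φ hφ
    rw [← h0, mul_zero] at this ⊢
    exact this
  · rw [← div_le_iff₀ h0]
    exact le_csInf ⟨C, h⟩ fun c hc => (div_le_iff₀ h0).2 (hc.2 φ hφ)

theorem isFiniteMeasure_restrict_of_isBounded (hb : Bornology.IsBounded Ω) :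
    IsFiniteMeasure (volume.restrict Ω) :=
  isFiniteMeasure_restrict.2 hb.measure_lt_top.ne

theorem isTorsionBound_of_infDist_compl_le {q : ℝ} (hpq : p.HolderConjugate q) (hc : Convex ℝ Ω)
    (ho : IsOpen Ω) (hb : Bornology.IsBounded Ω) (hΩ : Ω ≠ Set.univ) {K : ℝ} (hK0 : 0 ≤ K)
    (hK : ∀ x ∈ Ω, Metric.infDist x Ωᶜ ≤ K) :
    IsTorsionBound p Ω (K * volume.real Ω ^ (1 / q)) := by
  have := isFiniteMeasure_restrict_of_isBounded hb
  refine ⟨by positivity, fun φ hφ => ?_⟩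
  calc |∫ x in Ω, φ x| ≤ ∫ x in Ω, ‖φ x‖ := abs_integral_le_integral_abs
    _ ≤ K * ∫ x in Ω, ‖fderiv ℝ φ x‖ :=
        setIntegral_norm_le_of_infDist_compl_le hc ho hΩ hK0 hK hφ.contDiff_one hφ.compact
          hφ.support
    _ = K * ∫ x in Ω, ‖gradient φ x‖ := by simp only [norm_gradient]
    _ ≤ K * (volume.real Ω ^ (1 / q) *
          lpNorm (gradient φ) (ENNReal.ofReal p) (volume.restrict Ω)) := by
        grw [integral_norm_le_measureReal_rpow_mul_lpNorm hpq (hφ.memLp_gradient _),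
          measureReal_restrict_apply_univ]
    _ = _ := (mul_assoc _ _ _).symm

theorem norm_fst_le_of_mem_sobolevZero [Fact (1 ≤ ENNReal.ofReal p)] (hp : 1 < p)
    (hc : Convex ℝ Ω) (ho : IsOpen Ω) (hΩ : Ω ≠ Set.univ) {K : ℝ} (hK0 : 0 ≤ K)
    (hK : ∀ x ∈ Ω, Metric.infDist x Ωᶜ ≤ K) {w} (hw : w ∈ sobolevZero (ENNReal.ofReal p) Ω) :
    ‖w.1‖ ≤ K * p * ‖w.2‖ := by
  refine sobolevZero_induction (P := fun w => ‖w.1‖ ≤ K * p * ‖w.2‖)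
    (isClosed_le (by fun_prop) (by fun_prop)) (fun φ hφ => ?_) hw
  have hfderiv : AEStronglyMeasurable (fderiv ℝ φ) (volume.restrict Ω) :=
    (hφ.contDiff_one.continuous_fderiv one_ne_zero).aestronglyMeasurable
  rw [norm_toLp_eq_lpNorm, norm_toLp_eq_lpNorm, ← lpNorm_norm (hφ.memLp_gradient 1).1]
  simp only [norm_gradient]
  have hnorm := lpNorm_norm hfderiv (ENNReal.ofReal p)
  rw [hnorm]
  exact lpNorm_le_of_infDist_compl_le hc ho hΩ hK0 hK hp hφ.contDiff_one hφ.compact hφ.support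

theorem IsTorsionBound.abs_integral_le_of_mem_sobolevZero [Fact (1 ≤ ENNReal.ofReal p)]
    [IsFiniteMeasure (volume.restrict Ω)] (h : IsTorsionBound p Ω C) {w}
    (hw : w ∈ sobolevZero (ENNReal.ofReal p) Ω) : |∫ x in Ω, w.1 x| ≤ C * ‖w.2‖ := by
  refine sobolevZero_induction (P := fun w => |∫ x in Ω, w.1 x| ≤ C * ‖w.2‖)
    (isClosed_le (continuous_integral_Lp.comp continuous_fst).abs (by fun_prop))
    (fun φ hφ => ?_) hw
  rw [norm_toLp_eq_lpNorm, integral_congr_ae (MemLp.coeFn_toLp _)]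
  exact h.2 φ hφ

theorem IsTorsionBound.abs_integral_le [Fact (1 ≤ ENNReal.ofReal p)]
    [IsFiniteMeasure (volume.restrict Ω)] (h : IsTorsionBound p Ω C) (hu : MemW01p p Ω u G) :
    |∫ x in Ω, u x| ≤ C * lpNorm G (ENNReal.ofReal p) (volume.restrict Ω) := by
  rw [← norm_toLp_eq_lpNorm hu.memLp_grad, ← integral_congr_ae hu.memLp.coeFn_toLp]
  exact h.abs_integral_le_of_mem_sobolevZero hu.mem_sobolevZero

theorem IsTestFunction.memW01p {φ : E D → ℝ} (hφ : IsTestFunction Ω φ) :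
    MemW01p p Ω φ (gradient φ) :=
  ⟨⟨hφ.memLp _, hφ.memLp_gradient _, hφ.isWeakGradient⟩, fun _ => φ, fun _ => hφ, by simp, by simp⟩

end TorsionConst

section TorsionFunction

variable {D : ℕ} {p q C : ℝ} {Ω : Set (E D)} {u : E D → ℝ} {G : E D → E D}

theorem lpNorm_rpow_eq_integral_of_isTorsionFunction (hp : 0 < p) (hu : MemW01p p Ω u G)
    (hG : ∀ v H, MemW01p p Ω v H →
      ∫ x in Ω, ‖G x‖ ^ (p - 2) * inner ℝ (G x) (H x) = ∫ x in Ω, v x) :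
    lpNorm G (ENNReal.ofReal p) (volume.restrict Ω) ^ p = ∫ x in Ω, u x := by
  rw [lpNorm_rpow_eq_integral hp hu.memLp_grad.1, ← hG u G hu]
  simp only [norm_rpow_sub_two_mul_inner_self hp.ne']

theorem torsionConst_eq_lpNorm_rpow [IsFiniteMeasure (volume.restrict Ω)]
    (hpq : p.HolderConjugate q) (hC : IsTorsionBound p Ω C) (hu : MemW01p p Ω u G)
    (hG : ∀ v H, MemW01p p Ω v H →
      ∫ x in Ω, ‖G x‖ ^ (p - 2) * inner ℝ (G x) (H x) = ∫ x in Ω, v x) :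
    torsionConst p Ω = lpNorm G (ENNReal.ofReal p) (volume.restrict Ω) ^ (p - 1) := by
  have : Fact (1 ≤ ENNReal.ofReal p) := ⟨ENNReal.one_le_ofReal.2 hpq.lt.le⟩
  set N := lpNorm G (ENNReal.ofReal p) (volume.restrict Ω)
  have hN : 0 ≤ N := lpNorm_nonneg
  refine le_antisymm (torsionConst_le ⟨by positivity, fun φ hφ => ?_⟩) ?_
  · rw [← hG φ _ hφ.memW01p]
    exact abs_integral_norm_rpow_sub_two_mul_inner_le hpq hu.memLp_grad (hφ.memLp_gradient _)
  · have hle := hC.torsionConst.abs_integral_le hu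
    rw [← lpNorm_rpow_eq_integral_of_isTorsionFunction hpq.pos hu hG,
      abs_of_nonneg (by positivity)] at hle
    obtain h0 | h0 := hN.eq_or_lt
    · rw [← h0, Real.zero_rpow hpq.sub_one_pos.ne']
      exact hC.torsionConst.1
    · rwa [Real.rpow_sub_one h0.ne', div_le_iff₀ h0]

theorem IsTorsionFunction.integral_nonneg (hp : 0 < p) (hu : IsTorsionFunction p Ω u) :
    0 ≤ ∫ x in Ω, u x := by
  obtain ⟨G, hW, hG⟩ := hu
  rw [← lpNorm_rpow_eq_integral_of_isTorsionFunction hp hW hG]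
  exact Real.rpow_nonneg lpNorm_nonneg p

theorem IsTorsionFunction.torsionConst_rpow_eq [IsFiniteMeasure (volume.restrict Ω)]
    (hpq : p.HolderConjugate q) (hC : IsTorsionBound p Ω C) (hu : IsTorsionFunction p Ω u) :
    torsionConst p Ω ^ p = (∫ x in Ω, u x) ^ (p - 1) := by
  obtain ⟨G, hW, hG⟩ := hu
  rw [torsionConst_eq_lpNorm_rpow hpq hC hW hG,
    ← lpNorm_rpow_eq_integral_of_isTorsionFunction hpq.pos hW hG,
    ← Real.rpow_mul lpNorm_nonneg, ← Real.rpow_mul lpNorm_nonneg, mul_comm]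

end TorsionFunction

section LagrangeMultiplier

variable {X α F : Type*} [AddCommGroup X] [Module ℝ X] [NormedAddCommGroup F]
  [InnerProductSpace ℝ F] [MeasurableSpace α] {μ : Measure α} {p q : ℝ}
  [Fact (1 ≤ ENNReal.ofReal p)]

theorem integral_norm_rpow_sub_two_mul_inner_eq_norm_rpow_mul (hpq : p.HolderConjugate q)
    {S : Submodule ℝ (X × Lp F (ENNReal.ofReal p) μ)} {ℓ : X →ₗ[ℝ] ℝ}
    {w} (hw : w ∈ S) (hw1 : ℓ w.1 = 1) (hmin : ∀ z ∈ S, ℓ z.1 = 1 → ‖w.2‖ ≤ ‖z.2‖) {z}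
    (hz : z ∈ S) :
    ∫ x, ‖w.2 x‖ ^ (p - 2) * inner ℝ (w.2 x) (z.2 x) ∂μ = ‖w.2‖ ^ p * ℓ z.1 := by
  have hEL := integral_norm_rpow_sub_two_mul_inner_eq_zero hpq (g := w.2)
    (h := (z - ℓ z.1 • w).2) fun t => by
      refine hmin (w + t • (z - ℓ z.1 • w))
        (S.add_mem hw (S.smul_mem t (S.sub_mem hz (S.smul_mem _ hw)))) ?_
      simp [hw1]
  have hexpand : (fun x => ‖w.2 x‖ ^ (p - 2) * inner ℝ (w.2 x) ((z - ℓ z.1 • w).2 x)) =ᵐ[μ]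
      fun x => ‖w.2 x‖ ^ (p - 2) * inner ℝ (w.2 x) (z.2 x) - ‖w.2 x‖ ^ p * ℓ z.1 := by
    filter_upwards [Lp.coeFn_sub z.2 (ℓ z.1 • w.2), Lp.coeFn_smul (ℓ z.1) w.2] with x hsub hsmul
    rw [Prod.snd_sub, Prod.smul_snd, hsub, Pi.sub_apply, hsmul, Pi.smul_apply, inner_sub_right,
      inner_smul_right, mul_sub, mul_left_comm, norm_rpow_sub_two_mul_inner_self hpq.ne_zero,
      mul_comm (ℓ z.1)]
  have hnorm := norm_Lp_rpow (ENNReal.ofReal_pos.2 hpq.pos).ne' ENNReal.ofReal_ne_top w.2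
  rw [ENNReal.toReal_ofReal hpq.nonneg] at hnorm
  rw [integral_congr_ae hexpand,
    integral_sub (integrable_norm_rpow_sub_two_mul_inner hpq (Lp.memLp _) (Lp.memLp _))
      ((integrable_norm_rpow_ofReal hpq.pos (Lp.memLp _)).mul_const _),
    integral_mul_const, ← hnorm] at hEL
  exact sub_eq_zero.1 hEL

end LagrangeMultiplier

section IntegralLp

variable {α F : Type*} [MeasurableSpace α] {μ : Measure α} [IsFiniteMeasure μ]
  [NormedAddCommGroup F] [NormedSpace ℝ F] [CompleteSpace F] {r : ENNReal} [Fact (1 ≤ r)]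

/-- Integration, as a continuous linear map on `L^r` of a finite measure. -/
noncomputable def integralLp (F : Type*) [NormedAddCommGroup F] [NormedSpace ℝ F]
    [CompleteSpace F] (r : ENNReal) [Fact (1 ≤ r)] (μ : Measure α) [IsFiniteMeasure μ] :
    Lp F r μ →L[ℝ] F where
  toFun f := ∫ x, f x ∂μ
  map_add' f g := by
    rw [integral_congr_ae (Lp.coeFn_add f g)]
    exact integral_add ((Lp.memLp f).integrable Fact.out) ((Lp.memLp g).integrable Fact.out)
  map_smul' c f := by
    rw [integral_congr_ae (Lp.coeFn_smul c f)]
    exact integral_smul c f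
  cont := continuous_integral_Lp

theorem integralLp_apply (f : Lp F r μ) : integralLp F r μ f = ∫ x, f x ∂μ := rfl

end IntegralLp

section Existence

variable {D : ℕ} {p q : ℝ} {Ω : Set (E D)}

theorem isTorsionFunction_smul_of_minimal [Fact (1 ≤ ENNReal.ofReal p)]
    [IsFiniteMeasure (volume.restrict Ω)] (hpq : p.HolderConjugate q) {w}
    (hw : w ∈ sobolevZero (ENNReal.ofReal p) Ω) (hw0 : w.2 ≠ 0) (hw1 : ∫ x in Ω, w.1 x = 1)
    (hmin : ∀ z ∈ sobolevZero (ENNReal.ofReal p) Ω, ∫ x in Ω, z.1 x = 1 → ‖w.2‖ ≤ ‖z.2‖) :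
    IsTorsionFunction p Ω ((‖w.2‖ ^ p)⁻¹ ^ (p - 1)⁻¹ • w).1 := by
  have : 0 < ‖w.2‖ := norm_pos_iff.2 hw0
  set c := (‖w.2‖ ^ p)⁻¹ ^ (p - 1)⁻¹
  have hc0 : 0 < c := by positivity
  have hcp : c ^ (p - 1) = (‖w.2‖ ^ p)⁻¹ :=
    Real.rpow_inv_rpow (by positivity) hpq.sub_one_pos.ne'
  refine ⟨(c • w).2, memW01p_of_mem_sobolevZero ((sobolevZero _ Ω).smul_mem c hw),
    fun v H hv => ?_⟩
  have hEL := integral_norm_rpow_sub_two_mul_inner_eq_norm_rpow_mul hpq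
    (ℓ := integralLp ℝ (ENNReal.ofReal p) (volume.restrict Ω)) hw hw1 hmin hv.mem_sobolevZero
  calc ∫ x in Ω, ‖(c • w.2) x‖ ^ (p - 2) * inner ℝ ((c • w.2) x) (H x)
      = ∫ x in Ω, c ^ (p - 1) *
          (‖w.2 x‖ ^ (p - 2) * inner ℝ (w.2 x) (hv.memLp_grad.toLp H x)) := by
        refine integral_congr_ae ?_
        filter_upwards [Lp.coeFn_smul c w.2, hv.memLp_grad.coeFn_toLp] with x hsmul hH
        rw [hsmul, Pi.smul_apply, norm_smul_rpow_sub_two_mul_inner_smul hc0, hH]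
    _ = ∫ x in Ω, hv.memLp.toLp v x := by
        rw [integral_const_mul, hEL, hcp, inv_mul_cancel_left₀ (by positivity)]
        rfl
    _ = ∫ x in Ω, v x := integral_congr_ae hv.memLp.coeFn_toLp

end Existence

section ConvexDomain

variable {D : ℕ} {p : ℝ} {Ω : Set (E D)}

/-- Non-empty, open, bounded, convex sets. -/
structure IsConvexDomain (Ω : Set (E D)) : Prop where
  isOpen : IsOpen Ω
  isBounded : Bornology.IsBounded Ω
  convex : Convex ℝ Ω
  nonempty : Ω.Nonempty

theorem IsConvexDomain.ne_univ [NeZero D] (h : IsConvexDomain Ω) : Ω ≠ Set.univ := fun hΩ =>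
  NormedSpace.unbounded_univ ℝ (E D) (hΩ ▸ h.isBounded)

theorem IsConvexDomain.volume_pos (h : IsConvexDomain Ω) : 0 < volume.real Ω :=
  ENNReal.toReal_pos (h.isOpen.measure_pos _ h.nonempty).ne' h.isBounded.measure_lt_top.ne

theorem IsConvexDomain.exists_infDist_compl_le [NeZero D] (h : IsConvexDomain Ω) :
    ∃ K, 0 ≤ K ∧ ∀ x ∈ Ω, Metric.infDist x Ωᶜ ≤ K := by
  obtain ⟨y, hy⟩ := (Set.ne_univ_iff_exists_notMem Ω).1 h.ne_univ
  obtain ⟨K, hK0, hK⟩ := h.isBounded.subset_ball_lt 0 y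
  exact ⟨K, hK0.le, fun x hx => (Metric.infDist_le_dist_of_mem hy).trans (hK hx).le⟩

theorem IsConvexDomain.isTorsionBound [NeZero D] (h : IsConvexDomain Ω) (hp : 1 < p) :
    IsTorsionBound p Ω (torsionConst p Ω) := by
  obtain ⟨K, hK0, hK⟩ := h.exists_infDist_compl_le
  exact (isTorsionBound_of_infDist_compl_le (Real.HolderConjugate.conjExponent hp) h.convex
    h.isOpen h.isBounded h.ne_univ hK0 hK).torsionConst

theorem exists_isTestFunction_integral_pos (ho : IsOpen Ω) (hne : Ω.Nonempty) :
    ∃ φ, IsTestFunction Ω φ ∧ 0 < ∫ x in Ω, φ x := by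
  obtain ⟨x, hx⟩ := hne
  obtain ⟨r, hr, hsub⟩ := Metric.nhds_basis_closedBall.mem_iff.1 (ho.mem_nhds hx)
  let f : ContDiffBump x := ⟨r / 2, r, half_pos hr, half_lt_self hr⟩
  have hf : IsTestFunction Ω f := ⟨f.contDiff, f.hasCompactSupport, by rwa [f.tsupport_eq]⟩
  exact ⟨f, hf, hf.setIntegral_eq ▸ f.integral_pos⟩

theorem IsConvexDomain.torsionConst_pos [NeZero D] (h : IsConvexDomain Ω) (hp : 1 < p) :
    0 < torsionConst p Ω := by
  obtain ⟨φ, hφ, hpos⟩ := exists_isTestFunction_integral_pos h.isOpen h.nonempty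
  exact pos_of_mul_pos_left (((hpos.trans_le (le_abs_self _)).trans_le
    ((h.isTorsionBound hp).2 φ hφ))) lpNorm_nonneg

theorem IsConvexDomain.exists_isTorsionFunction [NeZero D] (h : IsConvexDomain Ω) (hp : 1 < p) :
    ∃ u, IsTorsionFunction p Ω u := by
  have hp1 : 1 < ENNReal.ofReal p := ENNReal.one_lt_ofReal.2 hp
  have : Fact (1 ≤ ENNReal.ofReal p) := ⟨hp1.le⟩
  have := isFiniteMeasure_restrict_of_isBounded h.isBounded
  have := uniformConvexSpace_Lp (F := E D) (μ := volume.restrict Ω) hp1 ENNReal.ofReal_ne_top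
  obtain ⟨K, hK0, hK⟩ := h.exists_infDist_compl_le
  obtain ⟨φ, hφ, hpos⟩ := exists_isTestFunction_integral_pos h.isOpen h.nonempty
  obtain ⟨w, hw, hw1, hmin⟩ := exists_norm_snd_le (sobolevZero (ENNReal.ofReal p) Ω)
    (Submodule.isClosed_topologicalClosure _)
    (fun w hw => norm_fst_le_of_mem_sobolevZero hp h.convex h.isOpen h.ne_univ hK0 hK hw)
    (integralLp ℝ (ENNReal.ofReal p) (volume.restrict Ω))
    ⟨_, Submodule.smul_mem _ (∫ x in Ω, φ x)⁻¹ hφ.mem_sobolevZero, by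
      rw [Prod.smul_fst, map_smul, integralLp_apply, integral_congr_ae (hφ.memLp _).coeFn_toLp,
        smul_eq_mul, inv_mul_cancel₀ hpos.ne']⟩
  refine ⟨_, isTorsionFunction_smul_of_minimal (Real.HolderConjugate.conjExponent hp) hw
    (fun hw0 => ?_) hw1 hmin⟩
  have hle := (h.isTorsionBound hp).abs_integral_le_of_mem_sobolevZero hw
  rw [← integralLp_apply, hw1, hw0, norm_zero, mul_zero, abs_one] at hle
  exact absurd hle (not_le.2 one_pos)

theorem IsConvexDomain.normTorsion_eq [NeZero D] (h : IsConvexDomain Ω) (hp : 1 < p) :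
    normTorsion p Ω = volume.real Ω ^ (p - 1) / torsionConst p Ω ^ p := by
  have := isFiniteMeasure_restrict_of_isBounded h.isBounded
  have hex := h.exists_isTorsionFunction hp
  rw [normTorsion, torsionalRigidity, dif_pos hex, hex.choose_spec.torsionConst_rpow_eq
    (Real.HolderConjugate.conjExponent hp) (h.isTorsionBound hp), div_eq_mul_inv,
    ← Real.rpow_neg (hex.choose_spec.integral_nonneg (one_pos.trans hp)), neg_sub]

end ConvexDomain

section Distance

open scoped Pointwise in
theorem infDist_smul_smul {V : Type*} [SeminormedAddCommGroup V] [NormedSpace ℝ V] {t : ℝ}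
    (ht : t ≠ 0) (x : V) (s : Set V) :
    Metric.infDist (t • x) (t • s) = |t| * Metric.infDist x s := by
  rw [Metric.infDist, infEDist_smul₀ ht, ENNReal.toReal_smul, NNReal.smul_def, coe_nnnorm,
    Real.norm_eq_abs, smul_eq_mul, Metric.infDist]

variable {V : Type*} [NormedAddCommGroup V] [NormedSpace ℝ V] [FiniteDimensional ℝ V] {Ω : Set V}

theorem infDist_frontier_eq_infDist_compl (hΩ : Ω ≠ Set.univ) {x : V} (hx : x ∈ Ω) :
    Metric.infDist x (frontier Ω) = Metric.infDist x Ωᶜ := by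
  obtain ⟨y, hy, hxy⟩ := exists_mem_frontier_infDist_compl_eq_dist hx hΩ
  refine le_antisymm (hxy ▸ Metric.infDist_le_dist_of_mem hy) ?_
  rw [← Metric.infDist_closure (s := Ωᶜ)]
  refine Metric.infDist_le_infDist_of_subset ?_ ⟨y, hy⟩
  rw [← frontier_compl]
  exact frontier_subset_closure

end Distance

section ShapeRatio

open scoped Pointwise

variable {D : ℕ} {p q : ℝ} {Ω : Set (E D)} {t : ℝ}

theorem IsConvexDomain.volume_real_mul_avgDist [NeZero D] (h : IsConvexDomain Ω) :
    volume.real Ω * avgDist Ω = ∫ x in Ω, Metric.infDist x Ωᶜ := by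
  rw [avgDist, ← mul_assoc, mul_one_div_cancel h.volume_pos.ne', one_mul]
  exact setIntegral_congr_fun h.isOpen.measurableSet fun x hx =>
    infDist_frontier_eq_infDist_compl h.ne_univ hx

theorem IsConvexDomain.smul (h : IsConvexDomain Ω) (ht : t ≠ 0) : IsConvexDomain (t • Ω) :=
  ⟨h.isOpen.smul₀ ht, h.isBounded.smul₀ t, h.convex.smul t, h.nonempty.smul_set⟩

theorem volume_real_smul (ht : 0 ≤ t) (Ω : Set (E D)) :
    volume.real (t • Ω) = t ^ D * volume.real Ω := by
  rw [measureReal_def, Measure.addHaar_smul_of_nonneg _ ht, ENNReal.toReal_mul,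
    finrank_euclideanSpace_fin, ENNReal.toReal_ofReal (by positivity), measureReal_def]

theorem setIntegral_smul_set {F : Type*} [NormedAddCommGroup F] [NormedSpace ℝ F] (ht : 0 < t)
    (Ω : Set (E D)) (f : E D → F) : ∫ x in t • Ω, f x = t ^ D • ∫ x in Ω, f (t • x) := by
  rw [Measure.setIntegral_comp_smul_of_pos _ _ _ ht, finrank_euclideanSpace_fin, smul_smul,
    mul_inv_cancel₀ (by positivity), one_smul]

theorem avgDist_smul (ht : 0 < t) (Ω : Set (E D)) : avgDist (t • Ω) = t * avgDist Ω := by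
  have hfrontier : frontier (t • Ω) = t • frontier Ω :=
    ((Homeomorph.smulOfNeZero t ht.ne').image_frontier Ω).symm
  have htD : t ^ D * (t ^ D)⁻¹ = 1 := mul_inv_cancel₀ (by positivity)
  rw [avgDist, avgDist, setIntegral_smul_set ht, volume_real_smul ht.le, hfrontier]
  simp only [infDist_smul_smul ht.ne', abs_of_pos ht, integral_const_mul, smul_eq_mul, one_div,
    mul_inv]
  linear_combination
    (volume.real Ω)⁻¹ * t * (∫ x in Ω, Metric.infDist x (frontier Ω)) * htD

theorem IsTestFunction.comp_smul (ht : t ≠ 0) {φ : E D → ℝ} (h : IsTestFunction (t • Ω) φ) :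
    IsTestFunction Ω fun x => φ (t • x) where
  smooth := h.smooth.comp (contDiff_const_smul t)
  compact := h.compact.comp_smul ht
  support x hx := by
    have hpre := tsupport_comp_eq_preimage φ (Homeomorph.smulOfNeZero t ht)
    exact (Set.smul_mem_smul_set_iff₀ ht Ω x).1 (h.support (hpre ▸ hx :))

theorem gradient_comp_smul (φ : E D → ℝ) (x : E D) :
    gradient (fun y => φ (t • y)) x = t • gradient φ (t • x) := by
  rw [gradient, gradient, fderiv_comp_smul, map_smul]

theorem lpNorm_gradient_smul_set (hp : 0 < p) (ht : 0 < t) {φ : E D → ℝ} (hφ : ContDiff ℝ 1 φ) :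
    lpNorm (gradient φ) (ENNReal.ofReal p) (volume.restrict (t • Ω)) =
      t ^ (D / p - 1) *
        lpNorm (gradient fun x => φ (t • x)) (ENNReal.ofReal p) (volume.restrict Ω) := by
  have hφt : Continuous (gradient fun x => φ (t • x)) :=
    continuous_gradient (hφ.comp (contDiff_const_smul t))
  rw [lpNorm_eq_integral_rpow hp (continuous_gradient hφ).aestronglyMeasurable,
    lpNorm_eq_integral_rpow hp hφt.aestronglyMeasurable,
    setIntegral_smul_set ht, smul_eq_mul]
  simp only [gradient_comp_smul, norm_smul, Real.norm_of_nonneg ht.le,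
    Real.mul_rpow ht.le (norm_nonneg _), integral_const_mul]
  have hI : 0 ≤ ∫ x in Ω, ‖gradient φ (t • x)‖ ^ p := integral_nonneg fun _ => by positivity
  rw [Real.mul_rpow (by positivity) hI, Real.mul_rpow (by positivity) hI, ← mul_assoc,
    one_div, Real.rpow_rpow_inv ht.le hp.ne', Real.rpow_sub_one ht.ne', div_mul_cancel₀ _ ht.ne',
    ← Real.rpow_natCast, ← Real.rpow_mul ht.le, div_eq_mul_inv]

theorem IsTorsionBound.smul (hpq : p.HolderConjugate q) (ht : 0 < t) {C : ℝ}
    (h : IsTorsionBound p Ω C) : IsTorsionBound p (t • Ω) (t ^ (D / q + 1) * C) := by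
  refine ⟨mul_nonneg (by positivity) h.1, fun φ hφ => ?_⟩
  rw [setIntegral_smul_set ht, smul_eq_mul, abs_mul, abs_of_pos (by positivity),
    lpNorm_gradient_smul_set hpq.pos ht hφ.contDiff_one]
  set N := lpNorm (gradient fun x => φ (t • x)) (ENNReal.ofReal p) (volume.restrict Ω)
  calc t ^ D * |∫ x in Ω, φ (t • x)| ≤ t ^ D * (C * N) := by
        gcongr
        exact h.2 _ (hφ.comp_smul ht.ne')
    _ = t ^ (D / q + 1) * t ^ (D / p - 1) * (C * N) := by
        rw [← Real.rpow_add ht, ← Real.rpow_natCast]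
        congr 2
        linear_combination -(D : ℝ) * hpq.inv_add_inv_eq_one
    _ = _ := by ring

theorem IsConvexDomain.torsionConst_smul [NeZero D] (h : IsConvexDomain Ω)
    (hpq : p.HolderConjugate q) (ht : 0 < t) :
    torsionConst p (t • Ω) = t ^ (D / q + 1) * torsionConst p Ω := by
  refine le_antisymm (torsionConst_le ((h.isTorsionBound hpq.lt).smul hpq ht)) ?_
  have hinv := torsionConst_le
    (((h.smul ht.ne').isTorsionBound hpq.lt).smul hpq (inv_pos.2 ht))
  rwa [inv_smul_smul₀ ht.ne', Real.inv_rpow ht.le, ← div_eq_inv_mul,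
    le_div_iff₀' (by positivity)] at hinv

/-- The scale invariant quantity `δ(Ω) T(p;Ω)^{1/p}`, with `q` the conjugate exponent of `p`. -/
noncomputable def shapeRatio (p q : ℝ) (Ω : Set (E D)) : ℝ :=
  avgDist Ω * volume.real Ω ^ (1 / q) / torsionConst p Ω

theorem IsConvexDomain.shapeRatio_smul [NeZero D] (h : IsConvexDomain Ω)
    (hpq : p.HolderConjugate q) (ht : 0 < t) : shapeRatio p q (t • Ω) = shapeRatio p q Ω := by
  rw [shapeRatio, shapeRatio, h.torsionConst_smul hpq ht, avgDist_smul ht,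
    volume_real_smul ht.le, Real.mul_rpow (by positivity) measureReal_nonneg,
    ← Real.rpow_natCast, ← Real.rpow_mul ht.le, Real.rpow_add ht, Real.rpow_one, mul_one_div,
    mul_mul_mul_comm, mul_comm t, mul_div_mul_left _ _ (by positivity)]

theorem IsConvexDomain.normTorsion_eq_shapeRatio [NeZero D] (h : IsConvexDomain Ω)
    (hpq : p.HolderConjugate q) (hδ : avgDist Ω ≠ 0) :
    normTorsion p Ω = (shapeRatio p q Ω / avgDist Ω) ^ p := by
  have hvol := h.volume_pos.le
  rw [h.normTorsion_eq hpq.lt, shapeRatio, mul_div_assoc, mul_div_cancel_left₀ _ hδ,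
    Real.div_rpow (by positivity) (h.torsionConst_pos hpq.lt).le, ← Real.rpow_mul hvol,
    one_div_mul_eq_div, hpq.div_conj_eq_sub_one]

end ShapeRatio

section BoundedSets

variable {X F : Type*} [MetricSpace X] [ProperSpace X] [MeasurableSpace X] [BorelSpace X]
  {μ : Measure X} [IsFiniteMeasureOnCompacts μ] [NormedAddCommGroup F] {s : Set X} {f : X → F}

theorem integrableOn_of_isBounded_of_continuous (hs : Bornology.IsBounded s) (hf : Continuous f) :
    IntegrableOn f s μ :=
  (hf.continuousOn.integrableOn_compact hs.isCompact_closure).mono_set subset_closure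

theorem memLp_of_isBounded_of_continuous [SecondCountableTopologyEither X F]
    (hs : Bornology.IsBounded s) (hf : Continuous f) (r : ENNReal) :
    MemLp f r (μ.restrict s) := by
  have : IsFiniteMeasure (μ.restrict s) := isFiniteMeasure_restrict.2 hs.measure_lt_top.ne
  obtain ⟨M, hM⟩ := hs.isCompact_closure.exists_bound_of_continuousOn hf.continuousOn
  refine MemLp.of_bound hf.aestronglyMeasurable M ?_
  filter_upwards [ae_restrict_of_ae_restrict_of_subset subset_closure
    (ae_restrict_mem (isClosed_closure (s := s)).measurableSet)] using hM

end BoundedSets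

section Mollification

open ContinuousLinearMap Convolution

variable {V F : Type*} [NormedAddCommGroup V] [NormedSpace ℝ V] [FiniteDimensional ℝ V]
  [HasContDiffBump V] [MeasurableSpace V] [BorelSpace V] {μ : Measure V} [μ.IsAddHaarMeasure]
  [NormedAddCommGroup F] [NormedSpace ℝ F] {f : V → F}
  {b : ContDiffBump (0 : V)}

theorem tsupport_normed_convolution_subset :
    tsupport (b.normed μ ⋆[lsmul ℝ ℝ, μ] f) ⊆ Metric.cthickening b.rOut (tsupport f) := by
  refine closure_minimal (fun x hx => ?_) Metric.isClosed_cthickening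
  obtain ⟨s, hs, y, hy, rfl⟩ := Set.mem_add.1 (support_convolution_subset _ hx)
  rw [b.support_normed_eq, mem_ball_zero_iff] at hs
  exact Metric.mem_cthickening_of_dist_le _ y _ _ (subset_tsupport f hy) (by simpa using hs.le)

theorem integral_normed_convolution [CompleteSpace F] (hf : Integrable f μ) :
    ∫ x, (b.normed μ ⋆[lsmul ℝ ℝ, μ] f) x ∂μ = ∫ x, f x ∂μ := by
  rw [integral_convolution _ b.integrable_normed hf, b.integral_normed, lsmul_apply, one_smul]

theorem norm_fderiv_normed_convolution_le (hf : Continuous f) {K R : ℝ} (hK : 0 ≤ K)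
    (hR : b.rOut < R) {x : V}
    (hlip : ∀ y ∈ Metric.ball x R, ∀ z ∈ Metric.ball x R, ‖f y - f z‖ ≤ K * ‖y - z‖) :
    ‖fderiv ℝ (b.normed μ ⋆[lsmul ℝ ℝ, μ] f) x‖ ≤ K := by
  have hint (y : V) : Integrable (fun s => b.normed μ s • f (y - s)) μ :=
    (b.continuous_normed.smul (hf.comp (continuous_sub_left y))).integrable_of_hasCompactSupport
      b.hasCompactSupport_normed.smul_right
  refine norm_fderiv_le_of_lip' ℝ hK ?_
  filter_upwards [Metric.ball_mem_nhds x (sub_pos.2 hR)] with y hy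
  have hbound (s : V) :
      ‖b.normed μ s • f (y - s) - b.normed μ s • f (x - s)‖ ≤ b.normed μ s * (K * ‖y - x‖) := by
    rw [← smul_sub, norm_smul, Real.norm_of_nonneg (b.nonneg_normed s)]
    by_cases hs : s ∈ Metric.ball 0 b.rOut
    · refine mul_le_mul_of_nonneg_left ?_ (b.nonneg_normed s)
      rw [mem_ball_iff_norm] at hy
      rw [mem_ball_zero_iff] at hs
      have hys : y - s ∈ Metric.ball x R := by
        rw [mem_ball_iff_norm, sub_right_comm]
        linarith [norm_sub_le (y - x) s]
      have hxs : x - s ∈ Metric.ball x R := by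
        rw [mem_ball_iff_norm, sub_sub_cancel_left, norm_neg]
        linarith
      simpa only [sub_sub_sub_cancel_right] using hlip _ hys _ hxs
    · rw [← b.support_normed_eq (μ := μ), Function.notMem_support] at hs
      rw [hs, zero_mul, zero_mul]
  calc ‖(b.normed μ ⋆[lsmul ℝ ℝ, μ] f) y - (b.normed μ ⋆[lsmul ℝ ℝ, μ] f) x‖
      = ‖∫ s, (b.normed μ s • f (y - s) - b.normed μ s • f (x - s)) ∂μ‖ := by
        rw [integral_sub (hint y) (hint x)]
        rfl
    _ ≤ ∫ s, b.normed μ s * (K * ‖y - x‖) ∂μ :=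
        norm_integral_le_of_norm_le (b.integrable_normed.mul_const _) (ae_of_all _ hbound)
    _ = K * ‖y - x‖ := by rw [integral_mul_const, b.integral_normed, one_mul]

end Mollification

section Lipschitz

open ContinuousLinearMap Convolution

variable {D : ℕ} {p C : ℝ} {Ω : Set (E D)} {v g : E D → ℝ}

theorem isTestFunction_normed_convolution {b : ContDiffBump (0 : E D)} {f : E D → ℝ}
    (hf : Integrable f) (hfc : HasCompactSupport f)
    (hfΩ : Metric.cthickening b.rOut (tsupport f) ⊆ Ω) :
    IsTestFunction Ω (b.normed volume ⋆[lsmul ℝ ℝ, volume] f) :=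
  ⟨b.hasCompactSupport_normed.contDiff_convolution_left _ b.contDiff_normed hf.locallyIntegrable,
    b.hasCompactSupport_normed.convolution _ hfc, tsupport_normed_convolution_subset.trans hfΩ⟩

theorem exists_isTestFunction_norm_gradient_le (ho : IsOpen Ω) (hb : Bornology.IsBounded Ω)
    (hv : Continuous v) (hvc : HasCompactSupport v) (hvΩ : tsupport v ⊆ Ω) (hg : Continuous g)
    (hg0 : 0 ≤ g) (hlip : ∀ x y, |v x - v y| ≤ max (g x) (g y) * ‖x - y‖) {ε : ℝ} (hε : 0 < ε) :
    ∃ φ, IsTestFunction Ω φ ∧ ∫ x in Ω, φ x = ∫ x in Ω, v x ∧ ∀ x, ‖gradient φ x‖ ≤ g x + ε := by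
  obtain ⟨r, hr, hrΩ⟩ := hvc.isCompact.exists_cthickening_subset_open ho hvΩ
  obtain ⟨R, hR, hgR⟩ := Metric.mem_uniformity_dist.1
    (hb.isCompact_closure.uniformContinuousAt_of_continuousAt g (fun x _ => hg.continuousAt)
      (Metric.dist_mem_uniformity hε))
  let b : ContDiffBump (0 : E D) := ⟨min r R / 4, min r R / 2, by positivity, by
    linarith [lt_min hr hR]⟩
  have hbr : b.rOut ≤ r := (half_le_self (lt_min hr hR).le).trans (min_le_left r R)
  have hbR : b.rOut < R := (half_lt_self (lt_min hr hR)).trans_le (min_le_right r R)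
  have hvi : Integrable v := hv.integrable_of_hasCompactSupport hvc
  have hφ := isTestFunction_normed_convolution hvi hvc ((Metric.cthickening_mono hbr _).trans hrΩ)
  refine ⟨_, hφ, ?_, fun x => ?_⟩
  · rw [hφ.setIntegral_eq, integral_normed_convolution hvi,
      setIntegral_eq_integral_of_forall_compl_eq_zero fun x hx =>
        image_eq_zero_of_notMem_tsupport fun h => hx (hvΩ h)]
  by_cases hx : x ∈ Ω
  · rw [norm_gradient]
    refine norm_fderiv_normed_convolution_le hv (add_nonneg (hg0 x) hε.le) hbR
      fun y hy z hz => (hlip y z).trans ?_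
    have hgx {w : E D} (hw : w ∈ Metric.ball x R) : g w ≤ g x + ε := by
      have hdist : dist (g x) (g w) < ε :=
        hgR (dist_comm w x ▸ hw : dist x w < R) (subset_closure hx)
      linarith [(abs_lt.1 hdist).1]
    gcongr
    exact max_le (hgx hy) (hgx hz)
  · have h0 : gradient (b.normed volume ⋆[lsmul ℝ ℝ, volume] v) x = 0 :=
      Function.notMem_support.1 fun h => hx (hφ.support (support_gradient_subset h))
    rw [h0, norm_zero]
    exact add_nonneg (hg0 x) hε.le

theorem IsTorsionBound.setIntegral_le_of_tsupport_subset (hp : 1 ≤ p) (ho : IsOpen Ω)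
    (hb : Bornology.IsBounded Ω) (hC : IsTorsionBound p Ω C) (hv : Continuous v)
    (hvc : HasCompactSupport v) (hvΩ : tsupport v ⊆ Ω) (hg : Continuous g) (hg0 : 0 ≤ g)
    (hlip : ∀ x y, |v x - v y| ≤ max (g x) (g y) * ‖x - y‖) :
    ∫ x in Ω, v x ≤ C * lpNorm g (ENNReal.ofReal p) (volume.restrict Ω) := by
  set N := lpNorm (1 : E D → ℝ) (ENNReal.ofReal p) (volume.restrict Ω)
  have hbound {ε : ℝ} (hε : 0 < ε) :
      ∫ x in Ω, v x ≤ C * (lpNorm g (ENNReal.ofReal p) (volume.restrict Ω) + ε * N) := by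
    obtain ⟨φ, hφ, hφv, hφg⟩ :=
      exists_isTestFunction_norm_gradient_le ho hb hv hvc hvΩ hg hg0 hlip hε
    have hgL := memLp_of_isBounded_of_continuous (μ := volume) hb hg (ENNReal.ofReal p)
    have h1L := memLp_of_isBounded_of_continuous (μ := volume) hb
      (continuous_const (y := (1 : ℝ))) (ENNReal.ofReal p)
    rw [← hφv]
    refine (le_abs_self _).trans ((hC.2 φ hφ).trans (mul_le_mul_of_nonneg_left ?_ hC.1))
    calc lpNorm (gradient φ) (ENNReal.ofReal p) (volume.restrict Ω)
        ≤ lpNorm (g + ε • 1) (ENNReal.ofReal p) (volume.restrict Ω) :=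
          lpNorm_mono_real (hgL.add (h1L.const_smul ε)) (by simpa using hφg)
      _ ≤ lpNorm g (ENNReal.ofReal p) (volume.restrict Ω) + ε * N := by
          refine (lpNorm_add_le hgL (ENNReal.one_le_ofReal.2 hp)).trans_eq ?_
          rw [lpNorm_const_smul, coe_nnnorm, Real.norm_of_nonneg hε.le]
  refine ge_of_tendsto (x := 𝓝[>] (0 : ℝ)) ?_
    (eventually_nhdsWithin_of_forall fun ε hε => hbound hε)
  exact tendsto_nhdsWithin_of_tendsto_nhds (Continuous.tendsto' (by fun_prop) _ _ (by simp))

theorem tsupport_max_sub_zero_subset {X : Type*} [TopologicalSpace X] {U : Set X} {f : X → ℝ}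
    {ε : ℝ} (hf : Continuous f) (hfU : ∀ x ∉ U, f x = 0) (hε : 0 < ε) :
    tsupport (fun x => max (f x - ε) 0) ⊆ U := fun x hx => by
  have hεx : ε ≤ f x := closure_minimal (fun y hy => by
    by_contra hlt
    exact hy (max_eq_right (sub_nonpos.2 (not_le.1 hlt).le)))
    (isClosed_le continuous_const hf) hx
  by_contra hxU
  exact (hε.trans_le hεx).ne' (hfU x hxU)

theorem IsTorsionBound.setIntegral_le (hp : 1 ≤ p) (ho : IsOpen Ω) (hb : Bornology.IsBounded Ω)
    (hC : IsTorsionBound p Ω C) (hv : Continuous v) (hvΩ : ∀ x ∉ Ω, v x = 0)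
    (hg : Continuous g) (hg0 : 0 ≤ g)
    (hlip : ∀ x y, |v x - v y| ≤ max (g x) (g y) * ‖x - y‖) :
    ∫ x in Ω, v x ≤ C * lpNorm g (ENNReal.ofReal p) (volume.restrict Ω) := by
  have := isFiniteMeasure_restrict_of_isBounded hb
  have hbound {ε : ℝ} (hε : 0 < ε) :
      ∫ x in Ω, v x ≤ C * lpNorm g (ENNReal.ofReal p) (volume.restrict Ω) +
        volume.real Ω * ε := by
    have hf : Continuous fun x => max (v x - ε) 0 := by fun_prop
    have hfΩ := tsupport_max_sub_zero_subset hv hvΩ hε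
    have hfc : HasCompactSupport fun x => max (v x - ε) 0 :=
      Metric.isCompact_of_isClosed_isBounded (isClosed_tsupport _) (hb.subset hfΩ)
    calc ∫ x in Ω, v x ≤ ∫ x in Ω, (max (v x - ε) 0 + ε) :=
          integral_mono (integrableOn_of_isBounded_of_continuous hb hv)
            (integrableOn_of_isBounded_of_continuous hb (hf.add_const ε))
            fun x => sub_le_iff_le_add.1 (le_max_left _ _)
      _ = (∫ x in Ω, max (v x - ε) 0) + volume.real Ω * ε := by
          rw [integral_add (integrableOn_of_isBounded_of_continuous hb hf) (integrable_const ε),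
            setIntegral_const, smul_eq_mul]
      _ ≤ _ := by
          gcongr
          refine hC.setIntegral_le_of_tsupport_subset hp ho hb hf hfc hfΩ hg hg0 fun x y => ?_
          refine (abs_max_sub_max_le_abs _ _ _).trans ?_
          rw [sub_sub_sub_cancel_right]
          exact hlip x y
  refine ge_of_tendsto (x := 𝓝[>] (0 : ℝ)) ?_
    (eventually_nhdsWithin_of_forall fun ε hε => hbound hε)
  exact tendsto_nhdsWithin_of_tendsto_nhds (Continuous.tendsto' (by fun_prop) _ _ (by simp))

end Lipschitz

section Concave

open AffineMap

variable {V : Type*} [NormedAddCommGroup V] [NormedSpace ℝ V] {Ω : Set V}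

theorem concaveOn_infDist_compl (hc : Convex ℝ Ω) :
    ConcaveOn ℝ Ω fun x => Metric.infDist x Ωᶜ := by
  refine ⟨hc, fun x hx y hy a b ha hb hab => ?_⟩
  simp only [smul_eq_mul]
  set r := a * Metric.infDist x Ωᶜ + b * Metric.infDist y Ωᶜ with hr
  have hr0 : 0 ≤ r := add_nonneg (mul_nonneg ha Metric.infDist_nonneg)
    (mul_nonneg hb Metric.infDist_nonneg)
  obtain hr0 | hr0 := hr0.eq_or_lt
  · exact hr0 ▸ Metric.infDist_nonneg
  have hne : Ωᶜ.Nonempty := by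
    by_contra! hempty
    simp [hr, hempty] at hr0
  refine (Metric.le_infDist hne).2 fun z hz => ?_
  by_contra! hlt
  rw [dist_comm, dist_eq_norm] at hlt
  set w := z - (a • x + b • y) with hw
  have hmem {u : V} (hu : u ∈ Ω) : u + (Metric.infDist u Ωᶜ / r) • w ∈ Ω := by
    obtain h0 | h0 := (Metric.infDist_nonneg (x := u) (s := Ωᶜ)).eq_or_lt
    · rwa [← h0, zero_div, zero_smul, add_zero]
    · have hdist : dist u (u + (Metric.infDist u Ωᶜ / r) • w) < Metric.infDist u Ωᶜ := by
        rw [dist_self_add_right, norm_smul, Real.norm_of_nonneg (by positivity),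
          div_mul_eq_mul_div, div_lt_iff₀ hr0]
        gcongr
      exact not_not.1 (Metric.notMem_of_dist_lt_infDist hdist)
  refine hz ?_
  convert! hc (hmem hx) (hmem hy) ha hb hab using 1
  have hsum : a * (Metric.infDist x Ωᶜ / r) + b * (Metric.infDist y Ωᶜ / r) = 1 := by
    rw [← mul_div_assoc, ← mul_div_assoc, ← add_div, div_self hr0.ne']
  rw [smul_add, smul_add, add_add_add_comm, smul_smul, smul_smul, ← add_smul, hsum, one_smul, hw]
  abel

theorem hasFDerivAt_homothety (x y : V) (t : ℝ) :
    HasFDerivAt (homothety x t) (t • ContinuousLinearMap.id ℝ V) y := by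
  have hcoe : ⇑(homothety x t) = fun y => t • (y - x) + x := funext fun y => homothety_apply x t y
  rw [hcoe]
  exact (((hasFDerivAt_id y).sub_const x).const_smul t).add_const x

theorem abs_det_smul_id {t : ℝ} (ht : 0 ≤ t) :
    |(t • ContinuousLinearMap.id ℝ V).det| = t ^ Module.finrank ℝ V := by
  rw [ContinuousLinearMap.det, ContinuousLinearMap.toLinearMap_smul, LinearMap.det_smul,
    ContinuousLinearMap.coe_id, LinearMap.det_id, mul_one, abs_of_nonneg (by positivity)]

variable {F : Type*} [NormedAddCommGroup F] [NormedSpace ℝ F]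
  [FiniteDimensional ℝ V] [MeasurableSpace V] [BorelSpace V] {μ : Measure V} [μ.IsAddHaarMeasure]
  {t : ℝ}

theorem setIntegral_homothety_image (hΩ : MeasurableSet Ω) (x : V) (ht : 0 < t) (f : V → F) :
    ∫ y in homothety x t '' Ω, f y ∂μ =
      t ^ Module.finrank ℝ V • ∫ y in Ω, f (homothety x t y) ∂μ := by
  rw [integral_image_eq_integral_abs_det_fderiv_smul μ hΩ
    (fun y _ => (hasFDerivAt_homothety x y t).hasFDerivWithinAt)
    (homothety_injective x ht.ne').injOn]
  simp only [abs_det_smul_id ht.le, integral_smul]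

theorem integrableOn_homothety_image (hΩ : MeasurableSet Ω) (x : V) (ht : 0 < t) {f : V → F} :
    IntegrableOn f (homothety x t '' Ω) μ ↔ IntegrableOn (fun y => f (homothety x t y)) Ω μ := by
  rw [integrableOn_image_iff_integrableOn_abs_det_fderiv_smul μ hΩ
    (fun y _ => (hasFDerivAt_homothety x y t).hasFDerivWithinAt)
    (homothety_injective x ht.ne').injOn]
  simp only [abs_det_smul_id ht.le]
  exact integrable_smul_iff (by positivity) _

theorem geom_sum_mul_setIntegral_ge_of_concaveOn {f : V → ℝ} (hΩ : MeasurableSet Ω)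
    (hμΩ : μ Ω ≠ ⊤) (hf : ConcaveOn ℝ Ω f) (hf0 : ∀ y ∈ Ω, 0 ≤ f y) (hfi : IntegrableOn f Ω μ)
    {x : V} (hx : x ∈ Ω) (ht : t ∈ Set.Ioo (0 : ℝ) 1) :
    t ^ Module.finrank ℝ V * (f x * μ.real Ω) ≤
      (∑ i ∈ Finset.range (Module.finrank ℝ V + 1), t ^ i) * ∫ y in Ω, f y ∂μ := by
  obtain ⟨ht0, ht1⟩ := ht
  have hsub : homothety x t '' Ω ⊆ Ω := by
    rintro _ ⟨y, hy, rfl⟩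
    rw [homothety_eq_lineMap]
    exact hf.1.lineMap_mem hx hy ⟨ht0.le, ht1.le⟩
  have hconc (y : V) (hy : y ∈ Ω) : (1 - t) * f x + t * f y ≤ f (homothety x t y) := by
    rw [homothety_eq_lineMap, lineMap_apply_module]
    exact hf.2 hx hy (sub_nonneg.2 ht1.le) ht0.le (sub_add_cancel 1 t)
  have hci : IntegrableOn (fun y => (1 - t) * f x + t * f y) Ω μ :=
    (integrableOn_const hμΩ).add (hfi.const_mul t)
  have hscale : t ^ Module.finrank ℝ V * ((1 - t) * (f x * μ.real Ω) + t * ∫ y in Ω, f y ∂μ) ≤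
      ∫ y in Ω, f y ∂μ :=
    calc _ = t ^ Module.finrank ℝ V * ∫ y in Ω, ((1 - t) * f x + t * f y) ∂μ := by
          have hconst : IntegrableOn (fun _ => (1 - t) * f x) Ω μ := integrableOn_const hμΩ
          rw [integral_add hconst (hfi.const_mul t), setIntegral_const,
            integral_const_mul, smul_eq_mul]
          ring
      _ ≤ t ^ Module.finrank ℝ V * ∫ y in Ω, f (homothety x t y) ∂μ := by
          refine mul_le_mul_of_nonneg_left (setIntegral_mono_on hci ?_ hΩ hconc) (by positivity)
          exact (integrableOn_homothety_image hΩ x ht0).1 (hfi.mono_set hsub)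
      _ = ∫ y in homothety x t '' Ω, f y ∂μ := (setIntegral_homothety_image hΩ x ht0 f).symm
      _ ≤ ∫ y in Ω, f y ∂μ := setIntegral_mono_set hfi
          ((ae_restrict_iff' hΩ).2 (ae_of_all _ hf0)) (ae_of_all _ hsub)
  have hgeom := mul_neg_geom_sum t (Module.finrank ℝ V + 1)
  refine le_of_mul_le_mul_left ?_ (sub_pos.2 ht1)
  rw [← mul_assoc (1 - t) (Finset.sum _ _), hgeom, pow_succ]
  linarith

theorem mul_measureReal_le_of_concaveOn {f : V → ℝ} (hΩ : MeasurableSet Ω)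
    (hμΩ : μ Ω ≠ ⊤) (hf : ConcaveOn ℝ Ω f) (hf0 : ∀ y ∈ Ω, 0 ≤ f y) (hfi : IntegrableOn f Ω μ)
    {x : V} (hx : x ∈ Ω) :
    f x * μ.real Ω ≤ (Module.finrank ℝ V + 1) * ∫ y in Ω, f y ∂μ := by
  have hle : ∀ᶠ t : ℝ in 𝓝[<] 1, t ^ Module.finrank ℝ V * (f x * μ.real Ω) ≤
      (∑ i ∈ Finset.range (Module.finrank ℝ V + 1), t ^ i) * ∫ y in Ω, f y ∂μ :=
    mem_of_superset (Ioo_mem_nhdsLT one_pos) fun t ht =>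
      geom_sum_mul_setIntegral_ge_of_concaveOn hΩ hμΩ hf hf0 hfi hx ht
  have hlhs : Continuous fun t : ℝ => t ^ Module.finrank ℝ V * (f x * μ.real Ω) := by fun_prop
  have hrhs : Continuous fun t : ℝ =>
      (∑ i ∈ Finset.range (Module.finrank ℝ V + 1), t ^ i) * ∫ y in Ω, f y ∂μ := by fun_prop
  simpa using le_of_tendsto_of_tendsto ((hlhs.tendsto 1).mono_left nhdsWithin_le_nhds)
    ((hrhs.tendsto 1).mono_left nhdsWithin_le_nhds) hle

end Concave

section ShapeRatioBounds

variable {D : ℕ} [NeZero D] {Ω : Set (E D)} {p q : ℝ}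

theorem IsConvexDomain.infDist_compl_le_avgDist (h : IsConvexDomain Ω) {x : E D} (hx : x ∈ Ω) :
    Metric.infDist x Ωᶜ ≤ (D + 1) * avgDist Ω := by
  have hle := mul_measureReal_le_of_concaveOn h.isOpen.measurableSet
    h.isBounded.measure_lt_top.ne (concaveOn_infDist_compl h.convex)
    (fun _ _ => Metric.infDist_nonneg)
    (integrableOn_of_isBounded_of_continuous h.isBounded (Metric.continuous_infDist_pt Ωᶜ)) hx
    (μ := volume)
  rw [← h.volume_real_mul_avgDist, finrank_euclideanSpace_fin, mul_left_comm, mul_comm] at hle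
  exact le_of_mul_le_mul_left hle h.volume_pos

theorem IsConvexDomain.avgDist_pos (h : IsConvexDomain Ω) : 0 < avgDist Ω := by
  obtain ⟨x, hx⟩ := h.nonempty
  have hpos : 0 < Metric.infDist x Ωᶜ :=
    (h.isOpen.isClosed_compl.notMem_iff_infDist_pos (Set.nonempty_compl.2 h.ne_univ)).1
      (not_not.2 hx)
  exact pos_of_mul_pos_right (hpos.trans_le (h.infDist_compl_le_avgDist hx)) (by positivity)

theorem IsConvexDomain.one_div_le_shapeRatio (h : IsConvexDomain Ω) (hpq : p.HolderConjugate q) :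
    1 / ((D : ℝ) + 1) ≤ shapeRatio p q Ω := by
  have hC : torsionConst p Ω ≤ (D + 1) * avgDist Ω * volume.real Ω ^ (1 / q) :=
    torsionConst_le (isTorsionBound_of_infDist_compl_le hpq h.convex h.isOpen h.isBounded
      h.ne_univ (mul_nonneg (by positivity) h.avgDist_pos.le)
      fun _ hx => h.infDist_compl_le_avgDist hx)
  rw [shapeRatio, div_le_div_iff₀ (by positivity) (h.torsionConst_pos hpq.lt), one_mul]
  linarith

theorem IsConvexDomain.shapeRatio_le_one (h : IsConvexDomain Ω) (hpq : p.HolderConjugate q) :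
    shapeRatio p q Ω ≤ 1 := by
  have hC := h.torsionConst_pos hpq.lt
  have hint : ∫ x in Ω, Metric.infDist x Ωᶜ ≤
      torsionConst p Ω * lpNorm (fun _ => (1 : ℝ)) (ENNReal.ofReal p) (volume.restrict Ω) := by
    refine (h.isTorsionBound hpq.lt).setIntegral_le hpq.lt.le h.isOpen h.isBounded
      (Metric.continuous_infDist_pt _) (fun x hx => Metric.infDist_zero_of_mem hx)
      continuous_const (fun _ => zero_le_one) fun x y => ?_
    rw [max_self, one_mul, ← dist_eq_norm, ← Real.dist_eq]
    exact (Metric.lipschitz_infDist_pt Ωᶜ).dist_le_mul_of_le le_rfl |>.trans_eq (one_mul _)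
  have hvol : volume.real Ω = volume.real Ω ^ (1 / p) * volume.real Ω ^ (1 / q) := by
    rw [← Real.rpow_add h.volume_pos, hpq.one_div_add_one_div, div_one, Real.rpow_one]
  have hpos : 0 < volume.real Ω ^ (1 / p) := Real.rpow_pos_of_pos h.volume_pos _
  rw [shapeRatio, div_le_one hC, ← mul_le_mul_iff_right₀ hpos]
  calc volume.real Ω ^ (1 / p) * (avgDist Ω * volume.real Ω ^ (1 / q))
      = volume.real Ω * avgDist Ω := by rw [mul_left_comm, ← hvol, mul_comm]
    _ = ∫ x in Ω, Metric.infDist x Ωᶜ := h.volume_real_mul_avgDist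
    _ ≤ torsionConst p Ω * volume.real Ω ^ (1 / p) := by
        rw [lpNorm_eq_integral_rpow hpq.pos aestronglyMeasurable_const] at hint
        simpa using hint
    _ = volume.real Ω ^ (1 / p) * torsionConst p Ω := mul_comm _ _

end ShapeRatioBounds

section BallGeometry

variable {V : Type*} [NormedAddCommGroup V] [NormedSpace ℝ V] [Nontrivial V]

theorem infDist_ball_compl {x : V} {r : ℝ} (hx : ‖x‖ ≤ r) :
    Metric.infDist x (Metric.ball 0 r)ᶜ = r - ‖x‖ := by
  have hr : 0 ≤ r := (norm_nonneg x).trans hx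
  obtain ⟨e, he⟩ := exists_norm_eq V zero_le_one
  obtain ⟨z, hz, hxz⟩ : ∃ z : V, ‖z‖ = r ∧ ‖x - z‖ = r - ‖x‖ := by
    obtain rfl | h0 := eq_or_ne x 0
    · exact ⟨r • e, by simp [norm_smul, he, abs_of_nonneg hr],
        by simp [norm_smul, he, abs_of_nonneg hr]⟩
    · have hx0 := norm_ne_zero_iff.2 h0
      refine ⟨(r / ‖x‖) • x, ?_, ?_⟩
      · rw [norm_smul, Real.norm_of_nonneg (by positivity), div_mul_cancel₀ _ hx0]
      · have hray : x - (r / ‖x‖) • x = -((r / ‖x‖ - 1) • x) := by module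
        have hone : 1 ≤ r / ‖x‖ := (one_le_div (norm_pos_iff.2 h0)).2 hx
        rw [hray, norm_neg, norm_smul, Real.norm_of_nonneg (sub_nonneg.2 hone), sub_mul,
          div_mul_cancel₀ _ hx0, one_mul]
  have hzmem : z ∈ (Metric.ball (0 : V) r)ᶜ := by simp [hz]
  refine le_antisymm ((Metric.infDist_le_dist_of_mem hzmem).trans_eq ?_)
    ((Metric.le_infDist ⟨z, hzmem⟩).2 fun y hy => ?_)
  · rw [dist_eq_norm, hxz]
  · have hy' : r ≤ ‖y‖ := by simpa using hy
    rw [dist_comm, dist_eq_norm]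
    linarith [norm_sub_norm_le y x]

variable [FiniteDimensional ℝ V] [MeasurableSpace V] [BorelSpace V] {μ : Measure V}
  [μ.IsAddHaarMeasure]

theorem setIntegral_ball_norm_rpow {s : ℝ} (hs : -(Module.finrank ℝ V : ℝ) < s) :
    ∫ x in Metric.ball 0 1, ‖x‖ ^ s ∂μ =
      μ.real (Metric.ball 0 1) * (Module.finrank ℝ V / (Module.finrank ℝ V + s)) := by
  have hradial : ∫ y in Set.Ioi (0 : ℝ), y ^ (Module.finrank ℝ V - 1) •
      (Set.Iio (1 : ℝ)).indicator (fun t => t ^ s) y = 1 / (Module.finrank ℝ V + s) :=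
    calc _ = ∫ y in Set.Ioi (0 : ℝ),
          (Set.Iio (1 : ℝ)).indicator (fun t => t ^ ((Module.finrank ℝ V : ℝ) - 1 + s)) y := by
          refine setIntegral_congr_fun measurableSet_Ioi fun y hy => ?_
          rw [Set.indicator_apply, Set.indicator_apply, Real.rpow_add hy, ← Real.rpow_natCast,
            Nat.cast_sub Module.finrank_pos, Nat.cast_one, smul_ite, smul_zero, smul_eq_mul]
      _ = ∫ y in (0 : ℝ)..1, y ^ ((Module.finrank ℝ V : ℝ) - 1 + s) := by
          rw [setIntegral_indicator measurableSet_Iio, Set.Ioi_inter_Iio,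
            ← integral_Ioc_eq_integral_Ioo, ← intervalIntegral.integral_of_le zero_le_one]
      _ = 1 / (Module.finrank ℝ V + s) := by
          rw [integral_rpow (Or.inl (by linarith)), Real.one_rpow, Real.zero_rpow (by linarith)]
          ring_nf
  have hpolar := integral_fun_norm_addHaar μ ((Set.Iio (1 : ℝ)).indicator fun t => t ^ s)
  rw [hradial, nsmul_eq_mul, smul_eq_mul] at hpolar
  have hind (x : V) : (Set.Iio (1 : ℝ)).indicator (fun t => t ^ s) ‖x‖ =
      (Metric.ball 0 1).indicator (fun x => ‖x‖ ^ s) x := by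
    simp only [Set.indicator, Set.mem_Iio, mem_ball_zero_iff]
  rw [← integral_indicator measurableSet_ball]
  simp only [← hind]
  rw [hpolar]
  ring

end BallGeometry

section Divergence

variable {V : Type*} [NormedAddCommGroup V] [InnerProductSpace ℝ V] [MeasurableSpace V]
  [BorelSpace V] {μ : Measure V} [μ.IsAddHaarMeasure] {f : V → ℝ}

theorem integrable_inner_mul_fderiv (hf : ContDiff ℝ 1 f) (hfs : HasCompactSupport f) (e : V) :
    Integrable (fun x => inner ℝ x e * fderiv ℝ f x e) μ := by
  have hcont : Continuous fun x => fderiv ℝ f x e :=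
    (hf.continuous_fderiv one_ne_zero).clm_apply continuous_const
  exact (Continuous.mul (by fun_prop) hcont).integrable_of_hasCompactSupport
    (hfs.fderiv_apply ℝ e).mul_left

variable [FiniteDimensional ℝ V]

theorem integral_inner_mul_fderiv_eq_neg (hf : ContDiff ℝ 1 f) (hfs : HasCompactSupport f)
    (e : V) : ∫ x, inner ℝ x e * fderiv ℝ f x e ∂μ = -(‖e‖ ^ 2 * ∫ x, f x ∂μ) := by
  have hfderiv (x : V) : fderiv ℝ (fun y => inner ℝ y e) x e = ‖e‖ ^ 2 := by
    rw [← real_inner_self_eq_norm_sq]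
    simpa using fderiv_inner_apply ℝ (differentiableAt_fun_id (x := x)) (differentiableAt_const e) e
  have hint := hf.continuous.integrable_of_hasCompactSupport hfs (μ := μ)
  rw [integral_mul_fderiv_eq_neg_fderiv_mul_of_integrable _ (integrable_inner_mul_fderiv hf hfs e),
    ← integral_const_mul]
  · simp only [hfderiv]
  · exact (Continuous.mul (by fun_prop) hf.continuous).integrable_of_hasCompactSupport hfs.mul_left
  · exact fun x _ => differentiableAt_fun_id.inner ℝ (differentiableAt_const e)
  · exact fun x _ => hf.differentiable one_ne_zero x
  · simpa only [hfderiv] using hint.const_mul _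

theorem finrank_mul_integral_eq_neg_integral_inner_gradient (hf : ContDiff ℝ 1 f)
    (hfs : HasCompactSupport f) :
    Module.finrank ℝ V * ∫ x, f x ∂μ = -∫ x, inner ℝ x (gradient f x) ∂μ := by
  set e := stdOrthonormalBasis ℝ V
  have hinner (x : V) : inner ℝ x (gradient f x) = ∑ i, inner ℝ x (e i) * fderiv ℝ f x (e i) := by
    rw [← e.sum_inner_mul_inner x]
    exact Finset.sum_congr rfl fun i _ => by
      rw [← real_inner_comm (e i) (gradient f x), inner_gradient_left]
  simp only [hinner]
  rw [integral_finsetSum _ fun i _ => integrable_inner_mul_fderiv hf hfs (e i)]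
  simp only [integral_inner_mul_fderiv_eq_neg hf hfs, e.norm_eq_one, one_pow, one_mul,
    Finset.sum_const, Finset.card_univ, Fintype.card_fin, nsmul_eq_mul, mul_neg, neg_neg]

end Divergence

section Ball

variable {D : ℕ} {p q : ℝ}

theorem isConvexDomain_ball : IsConvexDomain (Metric.ball (0 : E D) 1) :=
  ⟨Metric.isOpen_ball, Metric.isBounded_ball, convex_ball _ _, ⟨0, by simp⟩⟩

variable [NeZero D]

theorem avgDist_ball : avgDist (Metric.ball (0 : E D) 1) = 1 / (D + 1) := by
  have hV := (isConvexDomain_ball (D := D)).volume_pos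
  have hball := (isConvexDomain_ball (D := D)).isBounded
  have hnorm := setIntegral_ball_norm_rpow (V := E D) (μ := volume) (s := 1)
    (by rw [finrank_euclideanSpace_fin]; linarith [Nat.cast_nonneg (α := ℝ) D])
  simp only [Real.rpow_one, finrank_euclideanSpace_fin] at hnorm
  have hdist : ∫ x in Metric.ball (0 : E D) 1, Metric.infDist x (Metric.ball (0 : E D) 1)ᶜ =
      volume.real (Metric.ball (0 : E D) 1) * (1 / (D + 1)) :=
    calc _ = ∫ x in Metric.ball (0 : E D) 1, (1 - ‖x‖) :=
          setIntegral_congr_fun measurableSet_ball fun x hx =>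
            infDist_ball_compl (mem_ball_zero_iff.1 hx).le
      _ = volume.real (Metric.ball (0 : E D) 1) -
            volume.real (Metric.ball (0 : E D) 1) * (D / (D + 1)) := by
          rw [integral_sub (integrableOn_of_isBounded_of_continuous hball continuous_const)
            (integrableOn_of_isBounded_of_continuous hball continuous_norm), hnorm,
            setIntegral_const, smul_eq_mul, mul_one]
      _ = _ := by field_simp; ring
  rw [← isConvexDomain_ball.volume_real_mul_avgDist] at hdist
  exact mul_left_cancel₀ hV.ne' hdist

theorem isTorsionBound_ball (hpq : p.HolderConjugate q) :
    IsTorsionBound p (Metric.ball (0 : E D) 1)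
      (1 / D * (volume.real (Metric.ball (0 : E D) 1) * (D / (D + q))) ^ (1 / q)) := by
  have hq := hpq.symm.pos
  have hD0 : (0 : ℝ) < D := Nat.cast_pos.2 (NeZero.pos D)
  have hball := (isConvexDomain_ball (D := D)).isBounded
  refine ⟨by positivity, fun φ hφ => ?_⟩
  set B := Metric.ball (0 : E D) 1
  have hdiv : D * |∫ x in B, φ x| = |∫ x, inner ℝ x (gradient φ x)| := by
    have h := finrank_mul_integral_eq_neg_integral_inner_gradient (μ := volume) hφ.contDiff_one
      hφ.compact
    rw [finrank_euclideanSpace_fin] at h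
    rw [hφ.setIntegral_eq, ← abs_neg (∫ x, inner ℝ x _), ← h, abs_mul, Nat.abs_cast]
  have hnorm : lpNorm (id : E D → E D) (ENNReal.ofReal q) (volume.restrict B) =
      (volume.real B * (D / (D + q))) ^ (1 / q) := by
    have hs : -(Module.finrank ℝ (E D) : ℝ) < q := by
      rw [finrank_euclideanSpace_fin]
      linarith
    rw [lpNorm_eq_integral_rpow hq aestronglyMeasurable_id]
    simp only [id, setIntegral_ball_norm_rpow hs, finrank_euclideanSpace_fin, B]
  have hle : |∫ x, inner ℝ x (gradient φ x)| ≤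
      lpNorm (gradient φ) (ENNReal.ofReal p) (volume.restrict B) *
        (volume.real B * (D / (D + q))) ^ (1 / q) :=
    calc |∫ x, inner ℝ x (gradient φ x)| = |∫ x in B, inner ℝ x (gradient φ x)| := by
          rw [setIntegral_eq_integral_of_forall_compl_eq_zero fun x hx => ?_]
          have hx0 : gradient φ x = 0 := by
            by_contra h0
            exact hx (hφ.support (support_gradient_subset h0))
          rw [hx0, inner_zero_right]
      _ ≤ ∫ x in B, ‖gradient φ x‖ * ‖x‖ := by
          rw [← Real.norm_eq_abs]
          refine norm_integral_le_of_norm_le ?_ (ae_of_all _ fun x => ?_)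
          · exact integrableOn_of_isBounded_of_continuous hball
              ((continuous_gradient hφ.contDiff_one).norm.mul continuous_norm)
          · rw [mul_comm]
            exact abs_real_inner_le_norm _ _
      _ ≤ _ := hnorm ▸ integral_norm_mul_norm_le_lpNorm_mul_lpNorm hpq
          (hφ.memLp_gradient _) (memLp_of_isBounded_of_continuous hball continuous_id _)
  rw [mul_assoc, one_div, ← div_eq_inv_mul, le_div_iff₀ hD0, mul_comm, hdiv, mul_comm (_ ^ _)]
  exact hle

theorem le_shapeRatio_ball (hpq : p.HolderConjugate q) :
    D / (D + 1) * ((D + q) / D) ^ (1 / q) ≤ shapeRatio p q (Metric.ball (0 : E D) 1) := by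
  have hq := hpq.symm.pos
  have hD0 : (0 : ℝ) < D := Nat.cast_pos.2 (NeZero.pos D)
  have hV := (isConvexDomain_ball (D := D)).volume_pos
  rw [shapeRatio, avgDist_ball, le_div_iff₀ (isConvexDomain_ball.torsionConst_pos hpq.lt)]
  calc _ ≤ D / (D + 1) * ((D + q) / D) ^ (1 / q) *
        (1 / D * (volume.real (Metric.ball (0 : E D) 1) * (D / (D + q))) ^ (1 / q)) := by
        gcongr
        exact torsionConst_le (isTorsionBound_ball hpq)
    _ = 1 / (D + 1) * ((D + q) / D * (volume.real (Metric.ball (0 : E D) 1) *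
        (D / (D + q)))) ^ (1 / q) := by
        rw [Real.mul_rpow (x := (D + q) / D) (by positivity) (by positivity)]
        field_simp
    _ = _ := by
        congr 2
        field_simp

end Ball

section DistanceFunction

theorem abs_rpow_sub_rpow_le {q a b : ℝ} (hq : 1 ≤ q) (ha : 0 ≤ a) (hb : 0 ≤ b) :
    |a ^ q - b ^ q| ≤ q * max (a ^ (q - 1)) (b ^ (q - 1)) * |a - b| := by
  refine (convex_uIcc b a).norm_image_sub_le_of_norm_hasDerivWithin_le (f := fun x : ℝ => x ^ q)
    (f' := fun x => q * x ^ (q - 1)) (fun x _ => ?_) (fun x hx => ?_) Set.left_mem_uIcc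
    Set.right_mem_uIcc
  · exact (Real.hasDerivAt_rpow_const (Or.inr hq)).hasDerivWithinAt
  · have hx0 : 0 ≤ x := (le_min hb ha).trans hx.1
    have hq1 : 0 ≤ q - 1 := sub_nonneg.2 hq
    rw [Real.norm_of_nonneg (by positivity)]
    gcongr
    obtain hxb | hxa := le_max_iff.1 hx.2
    · exact le_max_of_le_right (Real.rpow_le_rpow hx0 hxb hq1)
    · exact le_max_of_le_left (Real.rpow_le_rpow hx0 hxa hq1)

variable {D : ℕ} {Ω : Set (E D)} {p q C : ℝ}

theorem IsTorsionBound.setIntegral_one_sub_infDist_rpow_le (hC : IsTorsionBound p Ω C)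
    (ho : IsOpen Ω) (hb : Bornology.IsBounded Ω) (hpq : p.HolderConjugate q)
    (hd : ∀ x, Metric.infDist x Ωᶜ ≤ 1) :
    ∫ x in Ω, (1 - (1 - Metric.infDist x Ωᶜ) ^ q) / q ≤
      C * (∫ x in Ω, (1 - Metric.infDist x Ωᶜ) ^ q) ^ (1 / p) := by
  have hq := hpq.symm.lt
  have hq0 := hpq.symm.pos
  have hd' (x : E D) : 0 ≤ 1 - Metric.infDist x Ωᶜ := sub_nonneg.2 (hd x)
  have hdcont : Continuous fun x => 1 - Metric.infDist x Ωᶜ :=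
    continuous_const.sub (Metric.continuous_infDist_pt _)
  have hcont {s : ℝ} (hs : 0 ≤ s) : Continuous fun x => (1 - Metric.infDist x Ωᶜ) ^ s :=
    hdcont.rpow_const fun _ => Or.inr hs
  have hg := hcont (sub_nonneg.2 hq.le)
  have hv : Continuous fun x => (1 - (1 - Metric.infDist x Ωᶜ) ^ q) / q :=
    (continuous_const.sub (hcont hq0.le)).div_const q
  have hnorm (x : E D) : ‖(1 - Metric.infDist x Ωᶜ) ^ (q - 1)‖ ^ p =
      (1 - Metric.infDist x Ωᶜ) ^ q := by
    rw [Real.norm_of_nonneg (Real.rpow_nonneg (hd' x) _), ← Real.rpow_mul (hd' x),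
      hpq.symm.sub_one_mul_conj]
  have hle := hC.setIntegral_le hpq.lt.le ho hb hv (fun x hx => ?_) hg
    (fun x => Real.rpow_nonneg (hd' x) _) fun x y => ?_
  · simpa only [lpNorm_eq_integral_rpow hpq.pos hg.aestronglyMeasurable, hnorm] using hle
  · simp only [Metric.infDist_zero_of_mem (show x ∈ Ωᶜ from hx), sub_zero, Real.one_rpow, sub_self,
      zero_div]
  · rw [div_sub_div_same, sub_sub_sub_cancel_left, abs_div, abs_of_pos hq0, div_le_iff₀' hq0,
      ← mul_assoc, max_comm]
    refine (abs_rpow_sub_rpow_le hq.le (hd' y) (hd' x)).trans ?_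
    rw [sub_sub_sub_cancel_left, ← dist_eq_norm]
    refine mul_le_mul_of_nonneg_left ?_
      (mul_nonneg hq0.le (le_max_of_le_left (Real.rpow_nonneg (hd' y) _)))
    rw [← Real.dist_eq]
    exact ((Metric.lipschitz_infDist_pt Ωᶜ).dist_le_mul_of_le le_rfl).trans_eq (one_mul _)

theorem IsConvexDomain.volume_sub_setIntegral_one_sub_infDist_rpow_le [NeZero D]
    (h : IsConvexDomain Ω) (hpq : p.HolderConjugate q) (hd : ∀ x, Metric.infDist x Ωᶜ ≤ 1) :
    volume.real Ω - ∫ x in Ω, (1 - Metric.infDist x Ωᶜ) ^ q ≤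
      q * (torsionConst p Ω * (∫ x in Ω, (1 - Metric.infDist x Ωᶜ) ^ q) ^ (1 / p)) := by
  have hint : IntegrableOn (fun x => (1 - Metric.infDist x Ωᶜ) ^ q) Ω :=
    integrableOn_of_isBounded_of_continuous h.isBounded
      ((continuous_const.sub (Metric.continuous_infDist_pt _)).rpow_const
        fun _ => Or.inr hpq.symm.pos.le)
  have hone : IntegrableOn (fun _ => (1 : ℝ)) Ω :=
    integrableOn_const h.isBounded.measure_lt_top.ne
  have hle := (h.isTorsionBound hpq.lt).setIntegral_one_sub_infDist_rpow_le h.isOpen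
    h.isBounded hpq hd
  rwa [integral_div, integral_sub hone hint, setIntegral_const, smul_eq_mul, mul_one,
    div_le_iff₀' hpq.symm.pos] at hle

theorem IsConvexDomain.shapeRatio_mul_one_sub_le [NeZero D] (h : IsConvexDomain Ω)
    (hpq : p.HolderConjugate q) (hd : ∀ x, Metric.infDist x Ωᶜ ≤ 1) {A : ℝ}
    (hA : ∫ x in Ω, (1 - Metric.infDist x Ωᶜ) ^ q ≤ volume.real Ω * A) :
    shapeRatio p q Ω * (1 - A) ≤ avgDist Ω * q * A ^ (1 / p) := by
  have hV := h.volume_pos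
  have hC := h.torsionConst_pos hpq.lt
  have hI0 : 0 ≤ ∫ x in Ω, (1 - Metric.infDist x Ωᶜ) ^ q :=
    integral_nonneg fun x => Real.rpow_nonneg (sub_nonneg.2 (hd x)) _
  have hA0 : 0 ≤ A := nonneg_of_mul_nonneg_right (hI0.trans hA) hV
  have hvol : volume.real Ω = volume.real Ω ^ (1 / p) * volume.real Ω ^ (1 / q) := by
    rw [← Real.rpow_add hV, hpq.one_div_add_one_div, div_one, Real.rpow_one]
  have hkey : volume.real Ω ^ (1 / q) * (1 - A) ≤ q * A ^ (1 / p) * torsionConst p Ω := by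
    refine le_of_mul_le_mul_left ?_ (Real.rpow_pos_of_pos hV (1 / p))
    calc volume.real Ω ^ (1 / p) * (volume.real Ω ^ (1 / q) * (1 - A))
        = volume.real Ω - volume.real Ω * A := by rw [← mul_assoc, ← hvol, mul_one_sub]
      _ ≤ volume.real Ω - ∫ x in Ω, (1 - Metric.infDist x Ωᶜ) ^ q := sub_le_sub_left hA _
      _ ≤ q * (torsionConst p Ω * (∫ x in Ω, (1 - Metric.infDist x Ωᶜ) ^ q) ^ (1 / p)) :=
        h.volume_sub_setIntegral_one_sub_infDist_rpow_le hpq hd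
      _ ≤ q * (torsionConst p Ω * (volume.real Ω * A) ^ (1 / p)) := by
        have := hpq.symm.pos
        have := hpq.pos
        gcongr
      _ = volume.real Ω ^ (1 / p) * (q * A ^ (1 / p) * torsionConst p Ω) := by
        rw [Real.mul_rpow hV.le hA0]
        ring
  rw [shapeRatio, div_mul_eq_mul_div, div_le_iff₀ hC, mul_assoc, mul_assoc, mul_assoc]
  rw [mul_assoc] at hkey
  exact mul_le_mul_of_nonneg_left hkey h.avgDist_pos.le

end DistanceFunction

section Box

variable {D : ℕ} {r : Fin D → ℝ}

/-- The open box in `ℝ^D` centred at the origin with half side lengths `r j`. -/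
def box (r : Fin D → ℝ) : Set (E D) := {x | ∀ j, |x j| < r j}

theorem box_eq_preimage_pi (r : Fin D → ℝ) :
    box r = WithLp.ofLp ⁻¹' Set.univ.pi fun j => Set.Ioo (-r j) (r j) := by
  ext x
  simp [box, abs_lt]

theorem box_mono {s : Fin D → ℝ} (h : r ≤ s) : box r ⊆ box s :=
  fun _ hx j => (hx j).trans_le (h j)

theorem isConvexDomain_box (hr : ∀ j, 0 < r j) : IsConvexDomain (box r) where
  isOpen := box_eq_preimage_pi r ▸
    (isOpen_set_pi Set.finite_univ fun _ _ => isOpen_Ioo).preimage (PiLp.continuous_ofLp 2 _)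
  isBounded := box_eq_preimage_pi r ▸
    (PiLp.antilipschitzWith_ofLp 2 _).isBounded_preimage
      (Bornology.IsBounded.pi fun _ => Metric.isBounded_Ioo _ _)
  convex := box_eq_preimage_pi r ▸
    (convex_pi fun _ _ => convex_Ioo _ _).linear_preimage
      (WithLp.linearEquiv 2 ℝ (Fin D → ℝ)).toLinearMap
  nonempty := ⟨0, fun j => by simpa using hr j⟩

theorem integral_box_prod (r : Fin D → ℝ) (f : Fin D → ℝ → ℝ) :
    ∫ x in box r, ∏ j, f j (x j) = ∏ j, ∫ t in Set.Ioo (-r j) (r j), f j t := by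
  have hpres := EuclideanSpace.volume_preserving_symm_measurableEquiv_toLp (Fin D)
  rw [box_eq_preimage_pi]
  refine (hpres.setIntegral_preimage_emb (MeasurableEquiv.measurableEmbedding _)
    (fun y : Fin D → ℝ => ∏ j, f j (y j)) _).trans ?_
  rw [volume_pi, Measure.restrict_pi_pi, integral_fintype_prod_eq_prod]

theorem infDist_box_compl_le {x : E D} {i : Fin D} (hx : |x i| ≤ r i) :
    Metric.infDist x (box r)ᶜ ≤ r i - |x i| := by
  obtain ⟨s, hs, hs'⟩ : ∃ s : ℝ, r i ≤ |x i + s| ∧ |s| = r i - |x i| := by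
    obtain h | h := abs_cases (x i)
    · refine ⟨r i - x i, by simpa using le_abs_self (r i), ?_⟩
      rw [abs_of_nonneg (by linarith), h.1]
    · refine ⟨-r i - x i, by simpa using le_abs_self (r i), ?_⟩
      rw [abs_of_nonpos (by linarith), h.1]
      ring
  have hmem : x + EuclideanSpace.single i s ∈ (box r)ᶜ :=
    fun hbox => (hbox i).not_ge (by simpa using hs)
  refine (Metric.infDist_le_dist_of_mem hmem).trans_eq ?_
  rw [dist_self_add_right, PiLp.norm_single, Real.norm_eq_abs, hs']

theorem le_infDist_box_compl [NeZero D] {x : E D} {a : ℝ}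
    (ha : ∀ j, a ≤ r j - |x j|) : a ≤ Metric.infDist x (box r)ᶜ := by
  have hne : EuclideanSpace.single 0 (r 0) ∈ (box r)ᶜ :=
    fun hbox => (hbox 0).not_ge (by simpa using le_abs_self (r 0))
  rw [Metric.le_infDist ⟨_, hne⟩]
  intro y hy
  obtain ⟨j, hj⟩ : ∃ j, r j ≤ |y j| := by simpa [box] using hy
  calc a ≤ |y j| - |x j| := (ha j).trans (sub_le_sub_right hj _)
    _ ≤ |(x - y) j| := abs_sub_comm (x j) (y j) ▸ abs_sub_abs_le_abs_sub _ _
    _ ≤ dist x y := dist_eq_norm x y ▸ PiLp.norm_apply_le (x - y) j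

end Box

section SlabBox

theorem integral_Ioo_abs_rpow {q : ℝ} (hq : 0 < q) :
    ∫ t in Set.Ioo (-1 : ℝ) 1, |t| ^ q = 2 / (q + 1) := by
  have hcont : Continuous fun t : ℝ => |t| ^ q := continuous_abs.rpow_const fun _ => Or.inr hq.le
  have hpos : ∫ t in (0 : ℝ)..1, |t| ^ q = 1 / (q + 1) := by
    have habs : ∫ t in (0 : ℝ)..1, |t| ^ q = ∫ t in (0 : ℝ)..1, t ^ q :=
      intervalIntegral.integral_congr fun t ht => by
        simp only [abs_of_nonneg (Set.uIcc_of_le (zero_le_one' ℝ) ▸ ht).1]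
    rw [habs, integral_rpow (Or.inl (by linarith)), Real.one_rpow, Real.zero_rpow (by linarith),
      sub_zero]
  have hneg : ∫ t in (-1 : ℝ)..0, |t| ^ q = 1 / (q + 1) := by
    rw [← hpos, ← neg_zero, ← intervalIntegral.integral_comp_neg]
    simp only [abs_neg, neg_zero]
  rw [← integral_Ioc_eq_integral_Ioo, ← intervalIntegral.integral_of_le (by norm_num),
    ← intervalIntegral.integral_add_adjacent_intervals (b := 0) (hcont.intervalIntegrable _ _)
      (hcont.intervalIntegrable _ _), hpos, hneg]
  ring

variable {D : ℕ} {i : Fin D} {L q : ℝ}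

/-- The box of half width `1` in the direction `i` and half width `L` in all others. As `L → ∞`
it approximates the slab `|x i| < 1`. -/
def slabBox (i : Fin D) (L : ℝ) : Set (E D) := box (Function.update (fun _ => L) i 1)

theorem isConvexDomain_slabBox (i : Fin D) (hL : 0 < L) : IsConvexDomain (slabBox i L) :=
  isConvexDomain_box fun j => by
    obtain rfl | hj := eq_or_ne j i
    · simp
    · simpa [hj] using hL

theorem integral_slabBox (i : Fin D) (hL : 0 ≤ L) (f : ℝ → ℝ) :
    ∫ x in slabBox i L, f (x i) = (∫ t in Set.Ioo (-1 : ℝ) 1, f t) * (2 * L) ^ (D - 1) := by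
  have hprod := integral_box_prod (Function.update (fun _ => L) i 1)
    (Function.update (fun _ _ => 1) i f)
  have hfactor (x : E D) :
      ∏ j, Function.update (fun _ _ => 1) i f j (x j) = f (x i) := by
    rw [Finset.prod_eq_single_of_mem i (Finset.mem_univ i), Function.update_self]
    intro j _ hj
    rw [Function.update_of_ne hj]
  have hside : ∏ j ∈ Finset.univ.erase i, ∫ t in Set.Ioo (-Function.update (fun _ => L) i 1 j)
      (Function.update (fun _ => L) i 1 j), Function.update (fun _ _ => 1) i f j t =
        (2 * L) ^ (D - 1) := by
    rw [Finset.prod_eq_pow_card (b := 2 * L), Finset.card_erase_of_mem (Finset.mem_univ i),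
      Finset.card_fin]
    intro j hj
    rw [Function.update_of_ne (Finset.ne_of_mem_erase hj),
      Function.update_of_ne (Finset.ne_of_mem_erase hj), setIntegral_const,
      Real.volume_real_Ioo_of_le (by linarith), smul_eq_mul]
    ring
  rw [← Finset.mul_prod_erase _ _ (Finset.mem_univ i), hside, Function.update_self,
    Function.update_self] at hprod
  simpa only [slabBox, hfactor] using hprod

theorem volume_slabBox (i : Fin D) (hL : 0 ≤ L) :
    volume.real (slabBox i L) = 2 * (2 * L) ^ (D - 1) := by
  have hint := integral_slabBox i hL fun _ => 1
  rw [setIntegral_const, setIntegral_const, smul_eq_mul, smul_eq_mul, mul_one, mul_one] at hint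
  rw [hint, Real.volume_real_Ioo_of_le (by norm_num)]
  norm_num

theorem infDist_slabBox_compl_le {x : E D} (hx : x ∈ slabBox i L) :
    Metric.infDist x (slabBox i L)ᶜ ≤ 1 - |x i| := by
  simpa [slabBox] using infDist_box_compl_le (hx i).le

theorem infDist_slabBox_compl_le_one (i : Fin D) (L : ℝ) (x : E D) :
    Metric.infDist x (slabBox i L)ᶜ ≤ 1 := by
  by_cases hx : x ∈ slabBox i L
  · exact (infDist_slabBox_compl_le hx).trans (sub_le_self _ (abs_nonneg _))
  · exact (Metric.infDist_zero_of_mem (Set.mem_compl hx)).trans_le zero_le_one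

theorem one_sub_abs_le_infDist_slabBox_compl [NeZero D] {x : E D}
    (hx : x ∈ slabBox i (L - 1)) : 1 - |x i| ≤ Metric.infDist x (slabBox i L)ᶜ := by
  refine le_infDist_box_compl fun j => ?_
  obtain rfl | hj := eq_or_ne j i
  · rw [Function.update_self]
  · have hxj := hx j
    rw [Function.update_of_ne hj] at hxj ⊢
    linarith [abs_nonneg (x i)]

theorem avgDist_slabBox_le [NeZero D] (i : Fin D) (hL : 0 < L) :
    avgDist (slabBox i L) ≤ 1 / 2 := by
  have hbox := isConvexDomain_slabBox i hL
  have habs : ∫ t in Set.Ioo (-1 : ℝ) 1, (1 - |t|) = 1 := by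
    have hint : ∫ t in Set.Ioo (-1 : ℝ) 1, |t| = 1 := by
      simpa [one_add_one_eq_two] using integral_Ioo_abs_rpow one_pos
    rw [integral_sub (by simp) ((continuous_abs.integrableOn_Icc).mono_set
      Set.Ioo_subset_Icc_self), hint]
    norm_num
  have hle : ∫ x in slabBox i L, Metric.infDist x (slabBox i L)ᶜ ≤
      ∫ x in slabBox i L, (1 - |x i|) :=
    setIntegral_mono_on
      (integrableOn_of_isBounded_of_continuous hbox.isBounded (Metric.continuous_infDist_pt _))
      (integrableOn_of_isBounded_of_continuous hbox.isBounded (by fun_prop))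
      hbox.isOpen.measurableSet fun _ hx => infDist_slabBox_compl_le hx
  rw [integral_slabBox i hL.le fun t => 1 - |t|, habs, ← hbox.volume_real_mul_avgDist] at hle
  refine le_of_mul_le_mul_left (hle.trans_eq ?_) hbox.volume_pos
  rw [volume_slabBox i hL.le]
  ring

theorem one_sub_infDist_slabBox_rpow_le [NeZero D] (i : Fin D) (L : ℝ) (hq : 0 ≤ q) (x : E D) :
    (1 - Metric.infDist x (slabBox i L)ᶜ) ^ q ≤
      |x i| ^ q + (1 - (slabBox i (L - 1)).indicator (fun _ => (1 : ℝ)) x) := by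
  have hd : 0 ≤ 1 - Metric.infDist x (slabBox i L)ᶜ :=
    sub_nonneg.2 (infDist_slabBox_compl_le_one i L x)
  by_cases hx : x ∈ slabBox i (L - 1)
  · rw [Set.indicator_of_mem hx, sub_self, add_zero]
    exact Real.rpow_le_rpow hd (sub_le_comm.1 (one_sub_abs_le_infDist_slabBox_compl hx)) hq
  · rw [Set.indicator_of_notMem hx, sub_zero]
    exact (Real.rpow_le_one hd (sub_le_self _ Metric.infDist_nonneg) hq).trans
      (le_add_of_nonneg_left (by positivity))

theorem integral_one_sub_infDist_slabBox_rpow_le [NeZero D] (i : Fin D) (hL : 1 < L)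
    (hq : 0 < q) :
    ∫ x in slabBox i L, (1 - Metric.infDist x (slabBox i L)ᶜ) ^ q ≤
      volume.real (slabBox i L) * (1 / (q + 1) + (1 - (1 - 1 / L) ^ (D - 1))) := by
  have hL0 : 0 < L := zero_lt_one.trans hL
  have hbox := isConvexDomain_slabBox i hL0
  have hcore : MeasurableSet (slabBox i (L - 1)) :=
    (isConvexDomain_slabBox i (sub_pos.2 hL)).isOpen.measurableSet
  have hsub : slabBox i (L - 1) ⊆ slabBox i L :=
    box_mono (update_le_update_iff.2 ⟨le_rfl, fun _ _ => sub_le_self _ zero_le_one⟩)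
  have hdist : Continuous fun x => (1 - Metric.infDist x (slabBox i L)ᶜ) ^ q :=
    (continuous_const.sub (Metric.continuous_infDist_pt _)).rpow_const fun _ => Or.inr hq.le
  have habs : IntegrableOn (fun x : E D => |x i| ^ q) (slabBox i L) :=
    integrableOn_of_isBounded_of_continuous hbox.isBounded
      (Continuous.rpow_const (by fun_prop) fun _ => Or.inr hq.le)
  have hone : IntegrableOn (fun _ => (1 : ℝ)) (slabBox i L) :=
    integrableOn_const hbox.isBounded.measure_lt_top.ne
  refine (setIntegral_mono_on (integrableOn_of_isBounded_of_continuous hbox.isBounded hdist)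
    (habs.add (hone.sub (hone.indicator hcore))) hbox.isOpen.measurableSet
    fun x _ => one_sub_infDist_slabBox_rpow_le i L hq.le x).trans_eq ?_
  rw [integral_add' habs (hone.sub (hone.indicator hcore)),
    integral_sub' hone (hone.indicator hcore), setIntegral_indicator hcore,
    Set.inter_eq_self_of_subset_right hsub, integral_slabBox i hL0.le fun t => |t| ^ q,
    integral_Ioo_abs_rpow hq, setIntegral_const, setIntegral_const, smul_eq_mul, smul_eq_mul,
    volume_slabBox i hL0.le, volume_slabBox i (sub_pos.2 hL).le, one_sub_div hL0.ne', div_pow,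
    mul_pow, mul_pow]
  field_simp

theorem mul_one_div_rpow_one_div {p q a : ℝ} (hpq : p.HolderConjugate q) (ha : 0 < a) :
    a * (1 / a) ^ (1 / p) = a ^ (1 / q) := by
  rw [one_div a, Real.inv_rpow ha.le, ← div_eq_mul_inv, div_eq_iff (Real.rpow_pos_of_pos ha _).ne',
    ← Real.rpow_add ha, hpq.symm.one_div_add_one_div, div_one, Real.rpow_one]

theorem exists_isConvexDomain_shapeRatio_lt [NeZero D] {p t : ℝ} (hpq : p.HolderConjugate q)
    (ht : 1 / 2 * (q + 1) ^ (1 / q) < t) :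
    ∃ Ω : Set (E D), IsConvexDomain Ω ∧ shapeRatio p q Ω < t := by
  have hq := hpq.symm.pos
  let A (L : ℝ) : ℝ := 1 / (q + 1) + (1 - (1 - 1 / L) ^ (D - 1))
  have hA : Tendsto A atTop (𝓝 (1 / (q + 1))) := by
    have hinv : Tendsto (fun L : ℝ => 1 / L) atTop (𝓝 0) := tendsto_const_nhds.div_atTop tendsto_id
    simpa [A] using ((hinv.const_sub 1).pow (D - 1)).const_sub 1 |>.const_add (1 / (q + 1))
  have hlim : Tendsto (fun L => t * (1 - A L) - 1 / 2 * q * A L ^ (1 / p)) atTop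
      (𝓝 (t * (1 - 1 / (q + 1)) - 1 / 2 * q * (1 / (q + 1)) ^ (1 / p))) :=
    ((hA.const_sub 1).const_mul t).sub
      ((hA.rpow_const (Or.inr hpq.one_div_nonneg)).const_mul (1 / 2 * q))
  have hlim_pos : 0 < t * (1 - 1 / (q + 1)) - 1 / 2 * q * (1 / (q + 1)) ^ (1 / p) := by
    refine pos_of_mul_pos_right (a := q + 1) ?_ (by positivity)
    calc 0 < q * (t - 1 / 2 * (q + 1) ^ (1 / q)) := mul_pos hq (sub_pos.2 ht)
      _ = _ := by
        rw [← mul_one_div_rpow_one_div hpq (by positivity : 0 < q + 1)]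
        field_simp
        ring
  have hA_lt : 1 / (q + 1) < 1 := (div_lt_one (by positivity)).2 (lt_add_of_pos_left 1 hq)
  have hA_pos : 0 < 1 / (q + 1) := by positivity
  obtain ⟨L, hpos, hA0, hA1, hL⟩ := ((hlim.eventually_const_lt hlim_pos).and <|
    (hA.eventually_const_lt hA_pos).and <| (hA.eventually_lt_const hA_lt).and <|
      eventually_gt_atTop 1).exists
  have hbox := isConvexDomain_slabBox (0 : Fin D) (zero_lt_one.trans hL)
  refine ⟨slabBox 0 L, hbox, lt_of_mul_lt_mul_right ?_ (sub_nonneg.2 hA1.le)⟩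
  calc shapeRatio p q (slabBox 0 L) * (1 - A L)
      ≤ avgDist (slabBox 0 L) * q * A L ^ (1 / p) :=
        hbox.shapeRatio_mul_one_sub_le hpq (infDist_slabBox_compl_le_one 0 L)
          (integral_one_sub_infDist_slabBox_rpow_le 0 hL hq)
    _ ≤ 1 / 2 * q * A L ^ (1 / p) := by
        gcongr
        exact avgDist_slabBox_le 0 (zero_lt_one.trans hL)
    _ < t * (1 - A L) := sub_pos.1 hpos

end SlabBox

section ShapeRatioRange

variable {D : ℕ} {Ω : Set (E D)} {p q r a b : ℝ}

theorem isConvexDomain_of_mem_convexDomains (hr : r ≠ 0) (h : Ω ∈ convexDomains D r) :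
    IsConvexDomain Ω where
  isOpen := h.1
  isBounded := h.2.1
  convex := h.2.2.1
  nonempty := Set.nonempty_iff_ne_empty.2 fun hΩ => hr <| by simp [← h.2.2.2, hΩ, avgDist]

theorem slab_lt_ball (hD : 2 ≤ D) (hq : 1 < q) :
    1 / 2 * (q + 1) ^ (1 / q) < D / (D + 1) * ((D + q) / D) ^ (1 / q) := by
  have hD' : (2 : ℝ) ≤ D := by exact_mod_cast hD
  have hq0 : 0 < q := zero_lt_one.trans hq
  have hs : 0 ≤ q * (D - 1) / (D + q) :=
    div_nonneg (mul_nonneg hq0.le (by linarith)) (by positivity)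
  have hbernoulli : (1 + q * (D - 1) / (D + q)) ^ (1 / q) < 2 * D / (D + 1) := calc
    (1 + q * (D - 1) / (D + q)) ^ (1 / q) ≤ 1 + 1 / q * (q * (D - 1) / (D + q)) :=
      rpow_one_add_le_one_add_mul_self (by linarith) (by positivity) ((div_le_one hq0).2 hq.le)
    _ = (2 * D - 1 + q) / (D + q) := by
      field_simp
      ring
    _ < 2 * D / (D + 1) := by
      rw [div_lt_div_iff₀ (by positivity) (by positivity)]
      nlinarith
  have hsplit : q + 1 = (1 + q * (D - 1) / (D + q)) * ((D + q) / D) := by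
    field_simp
    ring
  calc 1 / 2 * (q + 1) ^ (1 / q)
      = 1 / 2 * (1 + q * (D - 1) / (D + q)) ^ (1 / q) * ((D + q) / D) ^ (1 / q) := by
        rw [hsplit, Real.mul_rpow (by linarith) (by positivity), mul_assoc]
    _ < 1 / 2 * (2 * D / (D + 1)) * ((D + q) / D) ^ (1 / q) := by gcongr
    _ = D / (D + 1) * ((D + q) / D) ^ (1 / q) := by ring

/-- The set of values of the shape ratio on convex domains of `ℝ^D`. -/
def shapeRatios (D : ℕ) (p q : ℝ) : Set ℝ := shapeRatio p q '' {Ω : Set (E D) | IsConvexDomain Ω}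

theorem shapeRatios_nonempty (p q : ℝ) : (shapeRatios D p q).Nonempty :=
  ⟨_, _, isConvexDomain_ball, rfl⟩

variable [NeZero D]

theorem IsConvexDomain.exists_mem_convexDomains (h : IsConvexDomain Ω)
    (hpq : p.HolderConjugate q) (hr : 0 < r) :
    ∃ Ω' ∈ convexDomains D r, shapeRatio p q Ω' = shapeRatio p q Ω := by
  have ht : 0 < r / avgDist Ω := div_pos hr h.avgDist_pos
  have h' := h.smul ht.ne'
  refine ⟨_, ⟨h'.isOpen, h'.isBounded, h'.convex, ?_⟩, h.shapeRatio_smul hpq ht⟩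
  rw [avgDist_smul ht, div_mul_cancel₀ _ h.avgDist_pos.ne']

theorem image_normTorsion_convexDomains (hpq : p.HolderConjugate q) (hr : 0 < r) :
    normTorsion p '' convexDomains D r = (fun s => (s / r) ^ p) '' shapeRatios D p q := by
  have hnorm {Ω : Set (E D)} (hΩ : Ω ∈ convexDomains D r) :
      normTorsion p Ω = (shapeRatio p q Ω / r) ^ p := by
    have hδ : avgDist Ω = r := hΩ.2.2.2
    rw [(isConvexDomain_of_mem_convexDomains hr.ne' hΩ).normTorsion_eq_shapeRatio hpq
      (hδ ▸ hr.ne'), hδ]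
  ext y
  constructor
  · rintro ⟨Ω, hΩ, rfl⟩
    exact ⟨_, ⟨Ω, isConvexDomain_of_mem_convexDomains hr.ne' hΩ, rfl⟩, (hnorm hΩ).symm⟩
  · rintro ⟨_, ⟨Ω, hΩ, rfl⟩, rfl⟩
    obtain ⟨Ω', hΩ', hshape⟩ := IsConvexDomain.exists_mem_convexDomains hΩ hpq hr
    exact ⟨Ω', hΩ', by rw [hnorm hΩ', hshape]⟩

theorem shapeRatios_subset_Icc (hpq : p.HolderConjugate q) :
    shapeRatios D p q ⊆ Set.Icc (1 / ((D : ℝ) + 1)) 1 := by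
  rintro _ ⟨Ω, hΩ, rfl⟩
  exact ⟨IsConvexDomain.one_div_le_shapeRatio hΩ hpq, IsConvexDomain.shapeRatio_le_one hΩ hpq⟩

theorem pos_of_mem_shapeRatios (hpq : p.HolderConjugate q) {s : ℝ}
    (hs : s ∈ shapeRatios D p q) : 0 < s :=
  (by positivity : 0 < 1 / ((D : ℝ) + 1)).trans_le (shapeRatios_subset_Icc hpq hs).1

theorem bddBelow_shapeRatios (hpq : p.HolderConjugate q) :
    BddBelow (shapeRatios D p q) := bddBelow_Icc.mono (shapeRatios_subset_Icc hpq)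

theorem bddAbove_shapeRatios (hpq : p.HolderConjugate q) :
    BddAbove (shapeRatios D p q) := bddAbove_Icc.mono (shapeRatios_subset_Icc hpq)

theorem sInf_shapeRatios_lt_sSup (hD : 2 ≤ D) (hpq : p.HolderConjugate q) :
    sInf (shapeRatios D p q) < sSup (shapeRatios D p q) := by
  obtain ⟨Ω, hΩ, hlt⟩ := exists_isConvexDomain_shapeRatio_lt (D := D) hpq
    (slab_lt_ball hD hpq.symm.lt)
  calc sInf (shapeRatios D p q) ≤ shapeRatio p q Ω :=
        csInf_le (bddBelow_shapeRatios hpq) ⟨Ω, hΩ, rfl⟩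
    _ < shapeRatio p q (Metric.ball (0 : E D) 1) := hlt.trans_le (le_shapeRatio_ball hpq)
    _ ≤ sSup (shapeRatios D p q) :=
        le_csSup (bddAbove_shapeRatios hpq) ⟨_, isConvexDomain_ball, rfl⟩

theorem sSup_shapeRatios_pos (hpq : p.HolderConjugate q) :
    0 < sSup (shapeRatios D p q) := by
  obtain ⟨s, hs⟩ := shapeRatios_nonempty (D := D) p q
  exact (pos_of_mem_shapeRatios hpq hs).trans_le (le_csSup (bddAbove_shapeRatios hpq) hs)

/-- The sharp constant in the comparison of the normalized torsional rigidities of two convex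
domains in terms of their average distances to the boundary. -/
noncomputable def comparisonConst (D : ℕ) (p q : ℝ) : ℝ :=
  sInf (shapeRatios D p q) / sSup (shapeRatios D p q)

theorem comparisonConst_mem_Ico (hD : 2 ≤ D) (hpq : p.HolderConjugate q) :
    comparisonConst D p q ∈ Set.Ico (1 / ((D : ℝ) + 1)) 1 := by
  have hpos := sSup_shapeRatios_pos (D := D) hpq
  refine ⟨(le_div_iff₀ hpos).2 ?_, (div_lt_one hpos).2 (sInf_shapeRatios_lt_sSup hD hpq)⟩
  calc 1 / ((D : ℝ) + 1) * sSup (shapeRatios D p q) ≤ 1 / ((D : ℝ) + 1) :=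
        mul_le_of_le_one_right (by positivity) <|
          csSup_le (shapeRatios_nonempty p q) fun _ hs => (shapeRatios_subset_Icc hpq hs).2
    _ ≤ sInf (shapeRatios D p q) :=
        le_csInf (shapeRatios_nonempty p q) fun _ hs => (shapeRatios_subset_Icc hpq hs).1

theorem comparisonConst_mul_le (hpq : p.HolderConjugate q) {s t : ℝ}
    (hs : s ∈ shapeRatios D p q) (ht : t ∈ shapeRatios D p q) :
    comparisonConst D p q * t ≤ s := by
  rw [comparisonConst, div_mul_eq_mul_div, div_le_iff₀ (sSup_shapeRatios_pos hpq)]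
  exact mul_le_mul (csInf_le (bddBelow_shapeRatios hpq) hs) (le_csSup (bddAbove_shapeRatios hpq) ht)
    (pos_of_mem_shapeRatios hpq ht).le (pos_of_mem_shapeRatios hpq hs).le

theorem forall_mul_le_mul_iff_le_comparisonConst_mul (hpq : p.HolderConjugate q)
    (ha : 0 < a) (hb : 0 < b) :
    (∀ s ∈ shapeRatios D p q, ∀ t ∈ shapeRatios D p q, t * a ≤ s * b) ↔
      a ≤ comparisonConst D p q * b := by
  refine ⟨fun h => ?_, fun h s hs t ht => ?_⟩
  · rw [comparisonConst, div_mul_eq_mul_div, le_div_iff₀ (sSup_shapeRatios_pos hpq), mul_comm,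
      ← div_le_iff₀ hb]
    refine le_csInf (shapeRatios_nonempty p q) fun s hs => ?_
    rw [div_le_iff₀ hb, ← le_div_iff₀ ha]
    exact csSup_le (shapeRatios_nonempty p q) fun t ht => (le_div_iff₀ ha).2 (h s hs t ht)
  · calc t * a ≤ t * (comparisonConst D p q * b) :=
          mul_le_mul_of_nonneg_left h (pos_of_mem_shapeRatios hpq ht).le
      _ = comparisonConst D p q * t * b := by ring
      _ ≤ s * b := mul_le_mul_of_nonneg_right (comparisonConst_mul_le hpq hs ht) hb.le

theorem forall_normTorsion_iff_forall_shapeRatios (hpq : p.HolderConjugate q)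
    (ha : 0 < a) (hb : 0 < b) (R : ℝ → ℝ → Prop) :
    (∀ Ωa ∈ convexDomains D a, ∀ Ωb ∈ convexDomains D b,
        R (normTorsion p Ωb) (normTorsion p Ωa)) ↔
      ∀ s ∈ shapeRatios D p q, ∀ t ∈ shapeRatios D p q, R ((t / b) ^ p) ((s / a) ^ p) := by
  have himage : (∀ x ∈ normTorsion p '' convexDomains D a,
      ∀ y ∈ normTorsion p '' convexDomains D b, R y x) ↔
        ∀ x ∈ (fun s => (s / a) ^ p) '' shapeRatios D p q,
          ∀ y ∈ (fun t => (t / b) ^ p) '' shapeRatios D p q, R y x := by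
    rw [image_normTorsion_convexDomains hpq ha, image_normTorsion_convexDomains hpq hb]
  simpa only [Set.forall_mem_image] using himage

theorem forall_normTorsion_le_iff (hpq : p.HolderConjugate q) (ha : 0 < a)
    (hb : 0 < b) :
    (∀ Ωa ∈ convexDomains D a, ∀ Ωb ∈ convexDomains D b, normTorsion p Ωb ≤ normTorsion p Ωa) ↔
      a ≤ comparisonConst D p q * b := by
  rw [forall_normTorsion_iff_forall_shapeRatios hpq ha hb (· ≤ ·),
    ← forall_mul_le_mul_iff_le_comparisonConst_mul hpq ha hb]
  refine forall₄_congr fun s hs t ht => ?_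
  have hs := pos_of_mem_shapeRatios hpq hs
  have ht := pos_of_mem_shapeRatios hpq ht
  rw [Real.rpow_le_rpow_iff (by positivity) (by positivity) hpq.pos, div_le_div_iff₀ hb ha]

theorem normTorsion_lt_of_lt_comparisonConst_mul (hpq : p.HolderConjugate q)
    (ha : 0 < a) (hb : 0 < b) (hab : a < comparisonConst D p q * b) :
    ∀ Ωa ∈ convexDomains D a, ∀ Ωb ∈ convexDomains D b, normTorsion p Ωb < normTorsion p Ωa := by
  refine (forall_normTorsion_iff_forall_shapeRatios hpq ha hb (· < ·)).2 fun s hs t ht => ?_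
  have ht0 := pos_of_mem_shapeRatios hpq ht
  refine Real.rpow_lt_rpow (by positivity) ((div_lt_div_iff₀ hb ha).2 ?_) hpq.pos
  calc t * a < t * (comparisonConst D p q * b) := mul_lt_mul_of_pos_left hab ht0
    _ = comparisonConst D p q * t * b := by ring
    _ ≤ s * b := mul_le_mul_of_nonneg_right (comparisonConst_mul_le hpq hs ht) hb.le

theorem exists_seq_tendsto_normTorsion (hpq : p.HolderConjugate q) (hr : 0 < r)
    {x : ℝ} (hx : x ∈ closure (shapeRatios D p q)) :
    ∃ U : ℕ → Set (E D), (∀ n, U n ∈ convexDomains D r) ∧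
      Tendsto (fun n => normTorsion p (U n)) atTop (𝓝 ((x / r) ^ p)) := by
  obtain ⟨s, hs, hlim⟩ := mem_closure_iff_seq_limit.1 hx
  have hmem (n : ℕ) : (s n / r) ^ p ∈ normTorsion p '' convexDomains D r :=
    image_normTorsion_convexDomains (D := D) hpq hr ▸ Set.mem_image_of_mem _ (hs n)
  choose U hU hUs using hmem
  refine ⟨U, hU, ?_⟩
  simpa only [hUs] using (hlim.div_const r).rpow_const (Or.inr hpq.nonneg)

theorem exists_seqs_tendsto_normTorsion_of_comparisonConst_mul_eq
    (hpq : p.HolderConjugate q) (ha : 0 < a) (hb : 0 < b) (hab : comparisonConst D p q * b = a) :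
    ∃ U V : ℕ → Set (E D), (∀ n, U n ∈ convexDomains D a) ∧ (∀ n, V n ∈ convexDomains D b) ∧
      ∃ l : ℝ, Tendsto (fun n => normTorsion p (V n)) atTop (𝓝 l) ∧
        Tendsto (fun n => normTorsion p (U n)) atTop (𝓝 l) := by
  have hne := shapeRatios_nonempty (D := D) p q
  obtain ⟨U, hU, hUlim⟩ := exists_seq_tendsto_normTorsion hpq ha
    (csInf_mem_closure hne (bddBelow_shapeRatios hpq))
  obtain ⟨V, hV, hVlim⟩ := exists_seq_tendsto_normTorsion hpq hb
    (csSup_mem_closure hne (bddAbove_shapeRatios hpq))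
  have hlimit : sInf (shapeRatios D p q) / a = sSup (shapeRatios D p q) / b := by
    rw [div_eq_div_iff ha.ne' hb.ne', ← hab, comparisonConst, ← mul_assoc,
      mul_div_cancel₀ _ (sSup_shapeRatios_pos hpq).ne']
  exact ⟨U, V, hU, hV, _, hVlim, hlimit ▸ hUlim⟩

end ShapeRatioRange

end Torsion

theorem mainTheorem3_general (D : ℕ) (hD : 2 ≤ D) (p : ℝ) (hp : 1 < p) :
    ∃ γ : ℝ, γ ∈ Set.Ico (1 / ((D : ℝ) + 1)) 1 ∧
      ∀ a b : ℝ, 0 < a → 0 < b →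
        ((∀ Ωa ∈ Torsion.convexDomains D a, ∀ Ωb ∈ Torsion.convexDomains D b,
            Torsion.normTorsion p Ωb ≤ Torsion.normTorsion p Ωa) ↔ γ * b ≥ a) ∧
        (γ * b > a →
          ∀ Ωa ∈ Torsion.convexDomains D a, ∀ Ωb ∈ Torsion.convexDomains D b,
            Torsion.normTorsion p Ωb < Torsion.normTorsion p Ωa) ∧
        (γ * b = a →
          ∃ U V : ℕ → Set (Torsion.E D),
            (∀ n, U n ∈ Torsion.convexDomains D a) ∧
            (∀ n, V n ∈ Torsion.convexDomains D b) ∧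
            ∃ l : ℝ,
              Tendsto (fun n => Torsion.normTorsion p (V n)) atTop (𝓝 l) ∧
              Tendsto (fun n => Torsion.normTorsion p (U n)) atTop (𝓝 l)) := by
  have : NeZero D := ⟨by omega⟩
  have hpq := Real.HolderConjugate.conjExponent hp
  exact ⟨Torsion.comparisonConst D p p.conjExponent, Torsion.comparisonConst_mem_Ico hD hpq,
    fun a b ha hb => ⟨Torsion.forall_normTorsion_le_iff hpq ha hb,
      Torsion.normTorsion_lt_of_lt_comparisonConst_mul hpq ha hb,
      Torsion.exists_seqs_tendsto_normTorsion_of_comparisonConst_mul_eq hpq ha hb⟩⟩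

theorem mainTheorem3 (D : ℕ) (hD : 2 ≤ D) (p : ℝ) (hp : 1 < p) :
    ∃ γ : ℝ, γ ∈ Set.Ico (2 / ((D : ℝ) * ((D : ℝ) + 1))) 1 ∧
      ∀ a b : ℝ, 0 < a → a < b →
        ((∀ Ωa ∈ Torsion.convexDomains D a, ∀ Ωb ∈ Torsion.convexDomains D b,
            Torsion.normTorsion p Ωb ≤ Torsion.normTorsion p Ωa) ↔ γ * b ≥ a) ∧
        (γ * b > a →
          ∀ Ωa ∈ Torsion.convexDomains D a, ∀ Ωb ∈ Torsion.convexDomains D b,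
            Torsion.normTorsion p Ωb < Torsion.normTorsion p Ωa) ∧
        (γ * b = a →
          ∃ U V : ℕ → Set (Torsion.E D),
            (∀ n, U n ∈ Torsion.convexDomains D a) ∧
            (∀ n, V n ∈ Torsion.convexDomains D b) ∧
            ∃ l : ℝ,
              Tendsto (fun n => Torsion.normTorsion p (V n)) atTop (𝓝 l) ∧
              Tendsto (fun n => Torsion.normTorsion p (U n)) atTop (𝓝 l)) := by
  obtain ⟨γ, hγ, h⟩ := mainTheorem3_general D hD p hp
  have hD2 : (2 : ℝ) / (D * (D + 1)) ≤ 1 / (D + 1) := by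
    rw [← div_div]
    gcongr
    exact div_le_one_of_le₀ (by exact_mod_cast hD) D.cast_nonneg
  exact ⟨γ, ⟨hD2.trans hγ.1, hγ.2⟩, fun a b ha hab => h a b ha (ha.trans hab)⟩
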